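/- **Model.** Fix a non-empty alphabet $\Sigma$. A *glue* is a pair (label in $\Sigma^*$, strength in $\mathbb N$), with exactly one glue of strength $0$; a *tile type* assigns a glue to each of the four sides of a unit square (tiles are not rotated). Given a finite set $T$ of tile types, a *configuration* is a partial function $\alpha:\mathbb Z^2\dashrightarrow T$; two adjacent tiles bind with strength $s$ if their abutting glues are equal and have strength $s>0$. An *assembly* is a configuration with non-empty connected domain; it is *$\tau$-stable* if every cut of its binding graph has total weight at least $\tau$. A *tile-assembly system* (aTAM system) is a triple $\mathcal T=(T,\sigma,\tau)$ with $\tau\in\mathbb Z^+$ (the temperature) and $\sigma$ (the seed) a finite $\tau$-stable assembly of tiles from $T$. An assembly is *producible* if it is the result of a finite or infinite sequence of $\tau$-stable assemblies that starts with $\sigma$ and in which each assembly extends the previous one by exactly one tile (the result of an infinite sequence is the union of its assemblies), and *terminal* if it is $\tau$-stable and no tile can be added to it so that the result is $\tau$-stable. Each tile type of $T$ is coloured black or white. For $i,j<n$ let $\mathrm{SinglePixel}(n,i,j)$ be the pattern on the square $\{0,\dots,n-1\}^2$ that is black at $(i,j)$ and white everywhere else. The system *weakly self-assembles* this pattern if,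 in every producible terminal assembly, the set of locations of the tiles coloured black or white is exactly $\{0,\dots,n-1\}^2$ and the colour of the tile at each of these locations is the one prescribed by the pattern. **Theorem.** There is a function $f:\mathbb N\to\mathbb R$ with $f(n)=O(\log n)$ as $n\to\infty$ such that for all $n,i,j\in\mathbb N$ with $i,j<n$ there exist an aTAM system $\mathcal T=(T,\sigma,2)$ of temperature $2$ with $|\sigma|=1$ and $|T|\le f(n)$, and a colouring of its tile types by black and white, such that $\mathcal T$ weakly self-assembles $\mathrm{SinglePixel}(n,i,j)$. -/

import Mathlib

namespace ATAM

/-- Locations of the two-dimensional lattice. -/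
abbrev Pos := ℤ × ℤ

/-- The four sides of a unit square tile. -/
inductive Dir
  | north | east | south | west

/-- The unit vector pointing out of a side. -/
def Dir.vec : Dir → Pos
  | .north => (0, 1)
  | .east => (1, 0)
  | .south => (0, -1)
  | .west => (-1, 0)

/-- The opposite side. -/
def Dir.opp : Dir → Dir
  | .north => .south
  | .east => .west
  | .south => .north
  | .west => .east

/-- A glue: a finite string over the alphabet `A` together with a strength in `ℕ`.
There is only one glue of strength `0`, the null glue. -/
structure Glue (A : Type*) where
  label : List A
  strength : ℕ
  label_eq_nil_of_null : strength = 0 → label = []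

/-- A tile type: a glue on each of the four sides (tiles do not rotate). -/
abbrev TileType (A : Type*) := Dir → Glue A

/-- A configuration: a partial function from locations to tile types. -/
abbrev Config (A : Type*) := Pos → Option (TileType A)

namespace Config

variable {A : Type*}

/-- The locations that hold a tile. -/
def dom (α : Config A) : Set Pos := {p | ∃ t, α p = some t}

/-- All tiles of the configuration are of types in `T`. -/
def Over (α : Config A) (T : Finset (TileType A)) : Prop :=
  ∀ p t, α p = some t → t ∈ T

open Classical in
/-- The strength with which the tiles at `p` and at its neighbour in direction `d` interact;
it is `0` if one of the two locations is empty or the abutting glues differ. -/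
noncomputable def bond (α : Config A) (p : Pos) (d : Dir) : ℕ :=
  match α p, α (p + d.vec) with
  | some t, some u => if t d = u d.opp then (t d).strength else 0
  | _, _ => 0

open Classical in
/-- The weight of the cut of the binding graph that separates `X` from its complement: the total
strength of all bonds leaving `X`, as a supremum of finite sums. -/
noncomputable def cutWeight (α : Config A) (X : Set Pos) : ℕ∞ :=
  ⨆ F : Finset (Pos × Dir),
    ((∑ e ∈ F, if e.1 ∈ X ∧ e.1 + e.2.vec ∉ X then α.bond e.1 e.2 else 0 : ℕ) : ℕ∞)

/-- Every cut of the binding graph has weight at least `τ`. -/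
def Stable (τ : ℕ) (α : Config A) : Prop :=
  ∀ X : Set Pos, X ⊆ α.dom → X.Nonempty → (α.dom \ X).Nonempty → (τ : ℕ∞) ≤ α.cutWeight X

/-- `α` is a subassembly of `β`. -/
def Sub (α β : Config A) : Prop := ∀ p t, α p = some t → β p = some t

end Config

/-- The lattice `ℤ × ℤ` as a graph, with edges between locations at distance one. -/
def gridGraph : SimpleGraph Pos := SimpleGraph.fromRel fun p q => ∃ d : Dir, q = p + d.vec

/-- An assembly: a configuration whose domain is non-empty and connected. -/
def Config.IsAssembly {A : Type*} (α : Config A) : Prop :=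
  (gridGraph.induce α.dom).Connected

/-- A tile-assembly system `(T, σ, τ)`. -/
structure TAS (A : Type*) where
  tiles : Finset (TileType A)
  seed : Config A
  temp : ℕ
  temp_pos : 0 < temp
  seed_over : seed.Over tiles
  seed_isAssembly : seed.IsAssembly
  seed_finite : seed.dom.Finite
  seed_stable : seed.Stable temp

namespace TAS

variable {A : Type*}

/-- `α` produces `β` in one step: both are `τ`-stable assemblies of tiles from `T`, and `β`
arises from `α` by the addition of a single tile. -/
def Step (𝒯 : TAS A) (α β : Config A) : Prop :=
  (α.Over 𝒯.tiles ∧ α.IsAssembly ∧ α.Stable 𝒯.temp) ∧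
  (β.Over 𝒯.tiles ∧ β.IsAssembly ∧ β.Stable 𝒯.temp) ∧
  α.Sub β ∧ (β.dom \ α.dom).ncard = 1

/-- `β` is the result of a finite or of an infinite assembly sequence that starts with `α`. The
result of an infinite sequence consists of all tiles of all its assemblies. -/
def Produces (𝒯 : TAS A) (α β : Config A) : Prop :=
  Relation.ReflTransGen 𝒯.Step α β ∨
  ∃ s : ℕ → Config A, s 0 = α ∧ (∀ k, 𝒯.Step (s k) (s (k + 1))) ∧
    ∀ p t, β p = some t ↔ ∃ k, s k p = some t

/-- `α` is producible from the seed. -/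
def Producible (𝒯 : TAS A) (α : Config A) : Prop := 𝒯.Produces 𝒯.seed α

/-- `α` is stable and no tile can be added to it. -/
def Terminal (𝒯 : TAS A) (α : Config A) : Prop :=
  α.Stable 𝒯.temp ∧ ¬ ∃ β, 𝒯.Step α β

/-- The system, with tile types coloured by `color`, weakly self-assembles the pattern `P`: in every
producible terminal assembly, the locations of the tiles with colours in `CP` are exactly the
locations of `P`, and they have the colours that `P` prescribes. -/
def WeaklySelfAssembles {C : Type*} (𝒯 : TAS A) (color : TileType A → C) (CP : Set C)
    (P : Set (Pos × C)) : Prop :=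
  ∀ α, 𝒯.Producible α → 𝒯.Terminal α →
    {p | ∃ t, α p = some t ∧ color t ∈ CP} = Prod.fst '' P ∧
    ∀ p c, (p, c) ∈ P → ∃ t, α p = some t ∧ color t = c

end TAS

/-- The two colours of pixels. -/
inductive Color
  | white | black

/-- The `n × n` square `{0, …, n-1} × {0, …, n-1}`, white except for a black pixel at `(i, j)`. -/
def singlePixel (n i j : ℕ) : Set (Pos × Color) :=
  {x | (0 ≤ x.1.1 ∧ x.1.1 < n) ∧ (0 ≤ x.1.2 ∧ x.1.2 < n) ∧
    x.2 = if x.1 = ((i : ℤ), (j : ℤ)) then Color.black else Color.white}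

end ATAM

/-! ### Bonds, cuts and the stability of an assembly with one more tile. -/

namespace ATAM

/-! Let k = ⌈log₂ n⌉. In the lowest k rows the columns carry a binary counter that decreases
eastwards: n - x enters column x and n - x - 1 leaves it. The lowest set bit of n - x arrives by a
strength-2 glue, which starts the column. Below it the column grows down by strength-2 glues,
turning zeros into ones; above it digits are copied by cooperation of two strength-1 glues. On the
way up the glues compare n - x - 1 with n - 1 - k, n - 1 - i and n - 1 - j bit by bit, so the top of
the counter knows whether x is k, i or j. Only here do tiles need a row number, which gives O(k)
tile types.

Above the counter, column marks travel straight up. A diagonal starts at (k, k); each diagonal cell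
is entered with strength 2 and starts its row, which grows away from it in both directions by
cooperation. Column j meets the diagonal at (j, j), and there its mark becomes a mark of row j. The
cell (i, j) is the only one with both marks. This needs k ≤ j; otherwise the whole plan is reflected
vertically. For n < 7 every cell gets its own tile type.

Correctness rests on `Blueprint`: every glue in use has a direction of growth, the inputs of a cell
have total strength exactly 2, and they determine its tile. Then each attachment obeys the plan
(`Follows.step`) and growth cannot stop early (`Follows.exists_step`), so `terminal_eq` leaves one
terminal assembly. The core of the verification for the counter is `Fits.determined`;
`blueprint_unique` isolates the pixel. -/

instance : DecidableEq Dir := fun a b => by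
  cases a <;> cases b <;> first | exact isTrue rfl | exact isFalse (fun h => Dir.noConfusion h)

instance : Fintype Dir :=
  ⟨{.north, .east, .south, .west}, by rintro ⟨⟩ <;> simp⟩

theorem Dir.opp_opp (d : Dir) : d.opp.opp = d := by cases d <;> rfl

theorem Dir.add_vec_add_vec_opp (p : Pos) (d : Dir) : p + d.vec + d.opp.vec = p := by
  cases d <;> ext <;> simp [Dir.opp, Dir.vec]

theorem Dir.add_vec_ne (p : Pos) (d : Dir) : p + d.vec ≠ p := by
  cases d <;> simp [Dir.vec, Prod.ext_iff]

theorem Dir.sum_univ (f : Dir → ℕ) :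
    ∑ d, f d = f .north + f .east + f .south + f .west := by
  have : (Finset.univ : Finset Dir) = {.north, .east, .south, .west} := rfl
  rw [this]
  simp [add_assoc]

theorem gridGraph_adj (p : Pos) (d : Dir) : gridGraph.Adj p (p + d.vec) := by
  rw [gridGraph, SimpleGraph.fromRel_adj]
  exact ⟨(Dir.add_vec_ne p d).symm, Or.inl ⟨d, rfl⟩⟩

namespace Config

variable {A : Type*}

theorem bond_of_eq {α : Config A} {p : Pos} {d : Dir} {t u : TileType A} (hp : α p = some t)
    (hq : α (p + d.vec) = some u) (h : t d = u d.opp) : α.bond p d = (t d).strength := by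
  simp [bond, hp, hq, h]

theorem exists_of_bond_pos {α : Config A} {p : Pos} {d : Dir} (h : 0 < α.bond p d) :
    ∃ t u, α p = some t ∧ α (p + d.vec) = some u ∧ t d = u d.opp ∧
      α.bond p d = (t d).strength := by
  unfold bond at h ⊢
  rcases hp : α p with _ | t
  · simp [hp] at h
  rcases hq : α (p + d.vec) with _ | u
  · simp [hp, hq] at h
  by_cases e : t d = u d.opp
  · exact ⟨t, u, rfl, rfl, e, by simp [e]⟩
  · simp [hp, hq, e] at h

theorem bond_opp (α : Config A) (p : Pos) (d : Dir) :
    α.bond (p + d.vec) d.opp = α.bond p d := by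
  unfold bond
  rw [Dir.add_vec_add_vec_opp]
  rcases α p with _ | t <;> rcases α (p + d.vec) with _ | u <;> try rfl
  have h : t d.opp.opp = t d := congrArg t d.opp_opp
  by_cases e : t d = u d.opp
  · simp [h, e]
  · simp [h, e, Ne.symm e]

theorem bond_mono {α β : Config A} (h : α.Sub β) (p : Pos) (d : Dir) :
    α.bond p d ≤ β.bond p d := by
  rcases Nat.eq_zero_or_pos (α.bond p d) with h0 | h0
  · omega
  · obtain ⟨t, u, hp, hq, e, hb⟩ := exists_of_bond_pos h0
    rw [hb, bond_of_eq (h _ _ hp) (h _ _ hq) e]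

theorem cutWeight_singleton_le (α : Config A) (p : Pos) :
    α.cutWeight {p} ≤ ((∑ d, α.bond p d : ℕ) : ℕ∞) := by
  classical
  refine iSup_le fun F => ?_
  have hs : ∑ d, α.bond p d =
      ∑ e ∈ Finset.univ.image (fun d : Dir => (p, d)), α.bond e.1 e.2 := by
    rw [Finset.sum_image]
    intro a _ b _ h
    exact (Prod.ext_iff.1 h).2
  rw [hs]
  refine Nat.cast_le.2 ?_
  calc _ ≤ ∑ e ∈ F, (if e.1 = p then α.bond e.1 e.2 else 0) := by
        refine Finset.sum_le_sum fun e _ => ?_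
        by_cases h : e.1 = p <;> simp [h]
        split_ifs <;> simp
    _ = ∑ e ∈ F with e.1 = p, α.bond e.1 e.2 := (Finset.sum_filter _ _).symm
    _ ≤ _ := by
        refine Finset.sum_le_sum_of_subset fun e he => ?_
        rw [Finset.mem_filter] at he
        exact Finset.mem_image.2 ⟨e.2, Finset.mem_univ _, Prod.ext he.2.symm rfl⟩

open Classical in
theorem sum_le_cutWeight (α : Config A) (X : Set Pos) (F : Finset (Pos × Dir)) :
    ((∑ e ∈ F, if e.1 ∈ X ∧ e.1 + e.2.vec ∉ X then α.bond e.1 e.2 else 0 : ℕ) : ℕ∞) ≤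
      α.cutWeight X :=
  le_iSup (fun F : Finset (Pos × Dir) =>
    ((∑ e ∈ F, if e.1 ∈ X ∧ e.1 + e.2.vec ∉ X then α.bond e.1 e.2 else 0 : ℕ) : ℕ∞)) F

theorem sum_bond_le_cutWeight_singleton (α : Config A) (p : Pos) :
    ((∑ d, α.bond p d : ℕ) : ℕ∞) ≤ α.cutWeight {p} := by
  classical
  refine le_trans (Nat.cast_le.2 (le_of_eq ?_))
    (sum_le_cutWeight α {p} (Finset.univ.image (fun d : Dir => (p, d))))
  rw [Finset.sum_image (by intro a _ b _ h; exact (Prod.ext_iff.1 h).2)]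
  refine Finset.sum_congr rfl fun d _ => ?_
  have := Dir.add_vec_ne p d
  simp only [Set.mem_singleton_iff, true_and]
  rw [if_pos this]

/-- The bonds of the tile at `p` with its neighbours count towards every cut that has `p` on one
side and the neighbours on the other. -/
theorem sum_bond_le_cutWeight_of_notMem (α : Config A) (p : Pos) (X : Set Pos) (hp : p ∉ X)
    (hX : ∀ d, 0 < α.bond p d → p + d.vec ∈ X) :
    ((∑ d, α.bond p d : ℕ) : ℕ∞) ≤ α.cutWeight X := by
  classical
  refine le_trans (Nat.cast_le.2 ?_)
    (sum_le_cutWeight α X (Finset.univ.image (fun d : Dir => (p + d.vec, d.opp))))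
  rw [Finset.sum_image (by
    intro a _ b _ h
    have h' : a.opp = b.opp := (Prod.ext_iff.1 h).2
    rw [← Dir.opp_opp a, h', Dir.opp_opp])]
  refine Finset.sum_le_sum fun d _ => ?_
  rw [Dir.add_vec_add_vec_opp, bond_opp]
  rcases Nat.eq_zero_or_pos (α.bond p d) with h0 | h0
  · simp [h0]
  · simp [hX d h0, hp]

/-- Attaching a tile with total strength at least `τ` preserves stability. -/
theorem Stable.attach {τ : ℕ} {α β : Config A} {p : Pos} (hα : α.Stable τ) (hsub : α.Sub β)
    (hp : p ∉ α.dom) (hdom : β.dom = insert p α.dom) (hb : τ ≤ ∑ d, β.bond p d) :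
    β.Stable τ := by
  classical
  intro X hX hne hco
  by_cases h1 : (X \ {p}).Nonempty
  · by_cases h2 : (α.dom \ (X \ {p})).Nonempty
    -- Here X also cuts `α`. The bonds of `α` avoid p, so those crossing the cut of `α` cross the
    -- cut of `β` too.
    · refine (hα (X \ {p}) ?_ h1 h2).trans (iSup_le fun F => ?_)
      · rintro q ⟨hq, hqp⟩
        have := hX hq
        rw [hdom] at this
        exact this.resolve_left hqp
      · refine le_trans (Nat.cast_le.2 (Finset.sum_le_sum fun e _ => ?_))
          (sum_le_cutWeight β X F)
        rcases Nat.eq_zero_or_pos (α.bond e.1 e.2) with h0 | h0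
        · simp [h0]
        · obtain ⟨t, u, ht, hu, -, -⟩ := exists_of_bond_pos h0
          have hne : e.1 + e.2.vec ≠ p := fun h => hp ⟨u, h ▸ hu⟩
          by_cases hc : e.1 ∈ X \ {p} ∧ e.1 + e.2.vec ∉ X \ {p}
          · rw [if_pos hc, if_pos ⟨hc.1.1, fun h => hc.2 ⟨h, hne⟩⟩]
            exact bond_mono hsub _ _
          · rw [if_neg hc]
            exact Nat.zero_le _
    -- Here p is alone on the far side of the cut, so all its bonds cross.
    · have hsubX : α.dom ⊆ X := fun q hq => by
        by_contra hqX
        exact h2 ⟨q, hq, fun h => hqX h.1⟩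
      have hpX : p ∉ X := by
        intro hpX
        obtain ⟨q, hq, hqX⟩ := hco
        rw [hdom] at hq
        rcases hq with rfl | hq
        · exact hqX hpX
        · exact hqX (hsubX hq)
      refine le_trans (Nat.cast_le.2 hb) (sum_bond_le_cutWeight_of_notMem β p X hpX ?_)
      intro d hd
      obtain ⟨t, u, -, hu, -, -⟩ := exists_of_bond_pos hd
      have hmem : p + d.vec ∈ β.dom := ⟨u, hu⟩
      rw [hdom] at hmem
      exact hsubX (hmem.resolve_left (Dir.add_vec_ne p d))
  · have : X = {p} := by
      refine Set.eq_singleton_iff_nonempty_unique_mem.2 ⟨hne, fun q hq => ?_⟩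
      by_contra hqp
      exact h1 ⟨q, hq, hqp⟩
    rw [this]
    exact le_trans (Nat.cast_le.2 hb) (sum_bond_le_cutWeight_singleton β p)

theorem IsAssembly.attach {α β : Config A} {p : Pos} {d : Dir} (hα : α.IsAssembly)
    (hd : p + d.vec ∈ α.dom) (hdom : β.dom = insert p α.dom) : β.IsAssembly := by
  unfold IsAssembly at *
  have h : β.dom = {p, p + d.vec} ∪ α.dom := by
    rw [hdom]
    ext q
    simp only [Set.mem_insert_iff, Set.mem_union, Set.mem_singleton_iff]
    constructor
    · tauto
    · rintro ((h | h) | h)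
      · exact Or.inl h
      · exact Or.inr (h ▸ hd)
      · exact Or.inr h
  rw [h]
  exact SimpleGraph.induce_union_connected
    (SimpleGraph.induce_pair_connected_of_adj (gridGraph_adj p d)).preconnected hα.preconnected
    ⟨p + d.vec, by simp, hd⟩

open Classical in
/-- The configuration with a single tile. -/
noncomputable def single (p : Pos) (t : TileType A) : Config A := fun q =>
  if q = p then some t else none

theorem single_eq_some {p q : Pos} {t u : TileType A} :
    single p t q = some u ↔ q = p ∧ t = u := by
  unfold single
  split_ifs with h <;> simp [h]

theorem dom_single (p : Pos) (t : TileType A) : (single p t).dom = {p} := by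
  ext q
  simp [dom, single_eq_some]

theorem isAssembly_single (p : Pos) (t : TileType A) : (single p t).IsAssembly := by
  unfold IsAssembly
  rw [dom_single]
  exact { preconnected := fun a b => by rw [Subsingleton.elim a b], nonempty := ⟨p, rfl⟩ }

theorem stable_single (τ : ℕ) (p : Pos) (t : TileType A) : (single p t).Stable τ := by
  rw [Stable, dom_single]
  rintro X hX ⟨q, hq⟩ ⟨r, hr, hrX⟩
  obtain rfl : q = p := hX hq
  obtain rfl : r = q := hr
  exact absurd hq hrX

end Config

end ATAM

/-! ### Deterministic assembly plans and their unique terminal assembly. -/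

namespace ATAM

/-- A plan for a deterministic assembly at temperature 2. The sides of the cells carry labels, and
each label has a strength and a direction of growth. The inputs of a cell are the sides at which
growth enters it; they have total strength 2 at all cells but the seed, and they determine the
labels at the other sides. -/
structure Blueprint (L : Type) where
  cells : Finset Pos
  seed : Pos
  label : Pos → Dir → L
  strength : L → ℕ
  flow : L → Dir
  rank : Pos → ℕ
  seed_mem : seed ∈ cells
  label_opp : ∀ p d, label (p + d.vec) d.opp = label p d
  flow_axis : ∀ p ∈ cells, ∀ d, 0 < strength (label p d) →
    flow (label p d) = d ∨ flow (label p d) = d.opp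
  seed_input : ∀ d, 0 < strength (label seed d) → flow (label seed d) ≠ d.opp
  sum_input : ∀ p ∈ cells, p ≠ seed →
    ∑ d, (if flow (label p d) = d.opp then strength (label p d) else 0) = 2
  input_mem : ∀ p ∈ cells, ∀ d, 0 < strength (label p d) → flow (label p d) = d.opp →
    p + d.vec ∈ cells ∧ rank (p + d.vec) < rank p
  determined : ∀ q ∈ cells, q ≠ seed → ∀ p,
    (∀ d, 0 < strength (label q d) → flow (label q d) = d.opp →
      p + d.vec ∈ cells ∧ label p d = label q d) →
    p ∈ cells ∧ ∀ d, label p d = label q d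

namespace Blueprint

variable {L : Type} [Countable L] {A : Type*} (B : Blueprint L) (a : A)

/-- The glue for a label. -/
noncomputable def glue (l : L) : Glue A where
  -- One letter suffices: labels are numbered and written in unary.
  label := if B.strength l = 0 then []
    else List.replicate (Classical.choose (exists_injective_nat L) l) a
  strength := B.strength l
  label_eq_nil_of_null := fun h => if_pos h

theorem glue_injOn {l m : L} (hl : 0 < B.strength l) (h : B.glue a l = B.glue a m) : l = m := by
  have h1 : B.strength l = B.strength m := congrArg Glue.strength h
  have h2 := congrArg Glue.label h
  simp only [glue] at h2
  rw [if_neg (by omega), if_neg (by omega)] at h2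
  have h3 := congrArg List.length h2
  simp only [List.length_replicate] at h3
  exact Classical.choose_spec (exists_injective_nat L) h3

/-- The tile type of the cell `p`. -/
noncomputable def tile (p : Pos) : TileType A := fun d => B.glue a (B.label p d)

open Classical in
/-- The system that carries out the plan. -/
noncomputable def system : TAS A where
  tiles := B.cells.image (B.tile a)
  seed := Config.single B.seed (B.tile a B.seed)
  temp := 2
  temp_pos := by norm_num
  seed_over := by
    intro p t h
    rw [← (Config.single_eq_some.1 h).2]
    exact Finset.mem_image_of_mem _ B.seed_mem
  seed_isAssembly := Config.isAssembly_single _ _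
  seed_finite := by rw [Config.dom_single]; exact Set.finite_singleton _
  seed_stable := Config.stable_single _ _ _

/-- The configuration agrees with the plan, and each of its tiles was attached after the neighbours
at its inputs. -/
structure Follows (α : Config A) : Prop where
  eq_tile : ∀ p t, α p = some t → p ∈ B.cells ∧ t = B.tile a p
  seed_mem : B.seed ∈ α.dom
  input_mem : ∀ p ∈ α.dom, ∀ d, 0 < B.strength (B.label p d) →
    B.flow (B.label p d) = d.opp → p + d.vec ∈ α.dom

theorem follows_seed : B.Follows a (B.system a).seed where
  eq_tile p t h := by
    obtain ⟨rfl, rfl⟩ := Config.single_eq_some.1 h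
    exact ⟨B.seed_mem, rfl⟩
  seed_mem := by
    change B.seed ∈ (Config.single B.seed (B.tile a B.seed)).dom
    rw [Config.dom_single]
    rfl
  input_mem p hp d h0 h1 := by
    change p ∈ (Config.single B.seed (B.tile a B.seed)).dom at hp
    rw [Config.dom_single] at hp
    obtain rfl : p = B.seed := hp
    exact absurd h1 (B.seed_input d h0)

theorem Follows.dom_subset {B : Blueprint L} {a : A} {α : Config A} (h : B.Follows a α) :
    α.dom ⊆ B.cells := fun p ⟨t, ht⟩ => (h.eq_tile p t ht).1

theorem Follows.apply_of_mem {B : Blueprint L} {a : A} {α : Config A} (h : B.Follows a α) {p : Pos}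
    (hp : p ∈ α.dom) : α p = some (B.tile a p) := by
  obtain ⟨t, ht⟩ := hp
  rw [ht, (h.eq_tile p t ht).2]

/-- Let the type of a cell q attach at p. A bond at an output side of q would be an input of the
neighbour there, whose inputs are already filled, so p would be occupied. Hence only input sides
bind. Their strengths add up to exactly 2, so all of them bind, and `determined` shows that p was to
receive this very tile. -/
theorem Follows.step {B : Blueprint L} {a : A} {α β : Config A} (h : B.Follows a α)
    (hs : (B.system a).Step α β) : B.Follows a β := by
  classical
  obtain ⟨-, ⟨hover, -, hst⟩, hsub, hcard⟩ := hs
  obtain ⟨p, hp⟩ := Set.ncard_eq_one.1 hcard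
  have hpβ : p ∈ β.dom \ α.dom := hp ▸ rfl
  obtain ⟨⟨t, ht⟩, hpα⟩ := hpβ
  have hdom : ∀ q ∈ β.dom, q ≠ p → q ∈ α.dom := fun q hq hqp => by
    by_contra hqα
    have : q ∈ β.dom \ α.dom := ⟨hq, hqα⟩
    rw [hp] at this
    exact hqp this
  obtain ⟨q, hq, rfl⟩ := Finset.mem_image.1 (hover p t ht)
  -- The cut around p separates it from the seed.
  have hw : 2 ≤ ∑ d, β.bond p d := by
    have h1 := hst {p} (Set.singleton_subset_iff.2 ⟨_, ht⟩) ⟨p, rfl⟩ ⟨B.seed, ?_, ?_⟩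
    · exact_mod_cast h1.trans (Config.cutWeight_singleton_le β p)
    · obtain ⟨u, hu⟩ := h.seed_mem
      exact ⟨u, hsub _ _ hu⟩
    · intro e
      obtain rfl : B.seed = p := e
      exact hpα h.seed_mem
  have key : ∀ d, 0 < β.bond p d → B.flow (B.label q d) = d.opp ∧
      β.bond p d = B.strength (B.label q d) ∧ p + d.vec ∈ α.dom ∧
      B.label p d = B.label q d := by
    intro d hd
    obtain ⟨t', u, ht', hu, e, hb⟩ := Config.exists_of_bond_pos hd
    obtain rfl : B.tile a q = t' := Option.some.inj (ht.symm.trans ht')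
    have hmem : p + d.vec ∈ α.dom := hdom _ ⟨u, hu⟩ (Dir.add_vec_ne p d)
    obtain rfl : B.tile a (p + d.vec) = u :=
      Option.some.inj ((hsub _ _ (h.apply_of_mem hmem)).symm.trans hu)
    have hstr : 0 < B.strength (B.label q d) := by
      rw [hb] at hd
      exact hd
    have hl : B.label q d = B.label (p + d.vec) d.opp := B.glue_injOn a hstr e
    have hl' : B.label p d = B.label q d := by rw [hl, B.label_opp]
    refine ⟨(B.flow_axis q hq d hstr).resolve_left fun hf => hpα ?_, hb, hmem, hl'⟩
    have := h.input_mem _ hmem d.opp (hl ▸ hstr) (by rw [← hl, hf, Dir.opp_opp])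
    rwa [Dir.add_vec_add_vec_opp] at this
  have hle : ∀ d, β.bond p d ≤
      if B.flow (B.label q d) = d.opp then B.strength (B.label q d) else 0 := fun d => by
    rcases Nat.eq_zero_or_pos (β.bond p d) with h0 | h0
    · rw [h0]; exact Nat.zero_le _
    · obtain ⟨h1, h2, -⟩ := key d h0
      rw [if_pos h1, h2]
  -- The type of the seed has no inputs, so it could not bind.
  have hqs : q ≠ B.seed := by
    rintro rfl
    have h0 : ∑ d, β.bond p d ≤ 0 := by
      refine (Finset.sum_le_sum fun d _ => hle d).trans (le_of_eq (Finset.sum_eq_zero fun d _ => ?_))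
      by_contra hne
      split_ifs at hne with hf
      exact B.seed_input d (Nat.pos_of_ne_zero hne) hf
      exact hne rfl
    omega
  have hall : ∀ d, 0 < B.strength (B.label q d) → B.flow (B.label q d) = d.opp →
      0 < β.bond p d := by
    intro d h0 h1
    have heq := (Finset.sum_eq_sum_iff_of_le fun d _ => hle d).1
      (le_antisymm (Finset.sum_le_sum fun d _ => hle d)
        ((B.sum_input q hq hqs).le.trans hw)) d (Finset.mem_univ d)
    rw [heq, if_pos h1]
    exact h0
  obtain ⟨hpc, hpl⟩ := B.determined q hq hqs p fun d h0 h1 =>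
    ⟨h.dom_subset (key d (hall d h0 h1)).2.2.1, (key d (hall d h0 h1)).2.2.2⟩
  have htile : B.tile a q = B.tile a p := by
    funext d
    rw [tile, tile, hpl d]
  refine ⟨fun r u hu => ?_, ?_, fun r hr d h0 h1 => ?_⟩
  · by_cases hrp : r = p
    · subst hrp
      exact ⟨hpc, by rw [← htile, Option.some.inj (ht.symm.trans hu)]⟩
    · have hrα := hdom r ⟨u, hu⟩ hrp
      refine ⟨h.dom_subset hrα, ?_⟩
      exact Option.some.inj (hu.symm.trans (hsub _ _ (h.apply_of_mem hrα)))
  · obtain ⟨u, hu⟩ := h.seed_mem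
    exact ⟨u, hsub _ _ hu⟩
  · have hmem : r + d.vec ∈ α.dom := by
      by_cases hrp : r = p
      · subst hrp
        rw [hpl d] at h0 h1
        exact (key d (hall d h0 h1)).2.2.1
      · exact h.input_mem r (hdom r hr hrp) d h0 h1
    obtain ⟨u, hu⟩ := hmem
    exact ⟨u, hsub _ _ hu⟩

/-- As long as some cell is empty, a tile can be attached. -/
theorem Follows.exists_step {B : Blueprint L} {a : A} {α : Config A} (h : B.Follows a α)
    (hover : α.Over (B.system a).tiles) (hconn : α.IsAssembly) (hst : α.Stable 2)
    (hne : ¬ (B.cells : Set Pos) ⊆ α.dom) : ∃ β, (B.system a).Step α β := by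
  classical
  -- An empty cell of least rank has all its inputs filled, since they come from cells of smaller
  -- rank.
  obtain ⟨p, hp, hmin⟩ := Finset.exists_min_image (B.cells.filter (· ∉ α.dom)) B.rank (by
    obtain ⟨p, hp, hpα⟩ := Set.not_subset.1 hne
    exact ⟨p, Finset.mem_filter.2 ⟨hp, hpα⟩⟩)
  obtain ⟨hpc, hpα⟩ := Finset.mem_filter.1 hp
  have hps : p ≠ B.seed := by
    rintro rfl
    exact hpα h.seed_mem
  have hin : ∀ d, 0 < B.strength (B.label p d) → B.flow (B.label p d) = d.opp →
      p + d.vec ∈ α.dom := by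
    intro d h0 h1
    obtain ⟨hc, hr⟩ := B.input_mem p hpc d h0 h1
    by_contra hcon
    exact absurd (hmin _ (Finset.mem_filter.2 ⟨hc, hcon⟩)) (not_le.2 hr)
  let β : Config A := Function.update α p (some (B.tile a p))
  have hβp : β p = some (B.tile a p) := Function.update_self ..
  have hβ : ∀ q, q ≠ p → β q = α q := fun q hq => Function.update_of_ne hq ..
  have hsub : α.Sub β := by
    intro q t hq
    rw [hβ q (by rintro rfl; exact hpα ⟨t, hq⟩), hq]
  have hdom : β.dom = insert p α.dom := by
    ext q
    by_cases hq : q = p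
    · subst hq
      simp only [Set.mem_insert_iff, true_or, iff_true]
      exact ⟨_, hβp⟩
    · simp only [Set.mem_insert_iff, hq, false_or, Config.dom, Set.mem_ofPred_eq, hβ q hq]
  have hbond : ∀ d, (if B.flow (B.label p d) = d.opp then B.strength (B.label p d) else 0) ≤
      β.bond p d := by
    intro d
    split_ifs with hf
    · rcases Nat.eq_zero_or_pos (B.strength (B.label p d)) with h0 | h0
      · omega
      · have hq := hsub _ _ (h.apply_of_mem (hin d h0 hf))
        rw [Config.bond_of_eq hβp hq (by simp only [tile, B.label_opp])]
        exact le_rfl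
    · exact Nat.zero_le _
  have hsum := B.sum_input p hpc hps
  refine ⟨β, ⟨hover, hconn, hst⟩, ⟨?_, ?_, ?_⟩, hsub, ?_⟩
  · intro q t hq
    by_cases hqp : q = p
    · subst hqp
      rw [← Option.some.inj (hβp.symm.trans hq)]
      exact Finset.mem_image_of_mem _ hpc
    · exact hover q t (by rw [← hβ q hqp, hq])
  · obtain ⟨d, -, hd⟩ := Finset.exists_ne_zero_of_sum_ne_zero (by rw [hsum]; norm_num)
    have hf : B.flow (B.label p d) = d.opp := by
      by_contra hf
      exact hd (if_neg hf)
    rw [if_pos hf] at hd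
    exact hconn.attach (hin d (Nat.pos_of_ne_zero hd) hf) hdom
  · refine hst.attach hsub hpα hdom ?_
    rw [← hsum]
    exact Finset.sum_le_sum fun d _ => hbond d
  · rw [hdom, Set.ncard_eq_one]
    refine ⟨p, ?_⟩
    ext q
    simp only [Set.mem_sdiff, Set.mem_insert_iff, Set.mem_singleton_iff]
    constructor
    · rintro ⟨h1 | h1, h2⟩
      · exact h1
      · exact absurd h1 h2
    · rintro rfl
      exact ⟨Or.inl rfl, hpα⟩

/-- The assembly in which the plan is completed is the only terminal one. -/
theorem terminal_eq {α : Config A} (hα : (B.system a).Producible α)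
    (ht : (B.system a).Terminal α) :
    B.Follows a α ∧ α.dom = B.cells := by
  rcases hα with hα | ⟨s, hs0, hs, -⟩
  · have h : B.Follows a α ∧ α.Over (B.system a).tiles ∧ α.IsAssembly ∧ α.Stable 2 := by
      clear ht
      induction hα with
      | refl => exact ⟨B.follows_seed a, (B.system a).seed_over, (B.system a).seed_isAssembly,
          (B.system a).seed_stable⟩
      | tail _ hstep ih => exact ⟨ih.1.step hstep, hstep.2.1⟩
    refine ⟨h.1, Set.Subset.antisymm h.1.dom_subset ?_⟩
    by_contra hne
    exact ht.2 (h.1.exists_step h.2.1 h.2.2.1 h.2.2.2 hne)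
  -- An infinite sequence would put arbitrarily many tiles into finitely many cells.
  · exfalso
    have hf : ∀ k, B.Follows a (s k) := fun k => by
      induction k with
      | zero => rw [hs0]; exact B.follows_seed a
      | succ k ih => exact ih.step (hs k)
    have hcard : ∀ k, k ≤ (s k).dom.ncard := fun k => by
      induction k with
      | zero => exact Nat.zero_le _
      | succ k ih =>
        obtain ⟨-, -, hsub, h1⟩ := hs k
        have hss : (s k).dom ⊆ (s (k + 1)).dom := fun p ⟨t, ht⟩ => ⟨t, hsub p t ht⟩
        have := Set.ncard_sdiff_add_ncard_of_subset hss
          (B.cells.finite_toSet.subset (hf (k + 1)).dom_subset)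
        omega
    have h1 := hcard (B.cells.card + 1)
    have h2 := Set.ncard_le_ncard (hf (B.cells.card + 1)).dom_subset B.cells.finite_toSet
    rw [Set.ncard_coe_finset] at h2
    omega

/-- The cells of the square `{0, …, n-1} × {0, …, n-1}`. -/
noncomputable def square (n : ℕ) : Finset Pos := Finset.Ico 0 (n : ℤ) ×ˢ Finset.Ico 0 (n : ℤ)

theorem mem_square {n : ℕ} {p : Pos} :
    p ∈ square n ↔ (0 ≤ p.1 ∧ p.1 < n) ∧ (0 ≤ p.2 ∧ p.2 < n) := by
  simp [square]

open Classical in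
/-- A plan for the square in which no other cell has all the labels of the cell `(i, j)` yields the
pattern with the single pixel `(i, j)`. -/
theorem exists_weaklySelfAssembles_singlePixel {n i j : ℕ} (hcells : B.cells = square n)
    (huniq : ∀ p ∈ B.cells, (∀ d, 0 < B.strength (B.label ((i : ℤ), (j : ℤ)) d) →
      B.label p d = B.label ((i : ℤ), (j : ℤ)) d) → p = ((i : ℤ), (j : ℤ))) :
    ∃ (𝒯 : TAS A) (color : TileType A → Color),
      𝒯.temp = 2 ∧ 𝒯.seed.dom.ncard = 1 ∧ 𝒯.tiles = B.cells.image (B.tile a) ∧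
      𝒯.WeaklySelfAssembles color Set.univ (singlePixel n i j) := by
  refine ⟨B.system a, fun t => if t = B.tile a ((i : ℤ), (j : ℤ)) then .black else .white, rfl, ?_,
    rfl, ?_⟩
  · change (Config.single B.seed (B.tile a B.seed)).dom.ncard = 1
    rw [Config.dom_single, Set.ncard_singleton]
  · intro α hα ht
    obtain ⟨hf, hdom⟩ := B.terminal_eq a hα ht
    have hmem : ∀ p, p ∈ α.dom ↔ (0 ≤ p.1 ∧ p.1 < n) ∧ (0 ≤ p.2 ∧ p.2 < n) := fun p => by
      rw [hdom, Finset.mem_coe, hcells, mem_square]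
    refine ⟨?_, ?_⟩
    · ext p
      simp only [Set.mem_univ, and_true, Set.mem_image]
      change p ∈ α.dom ↔ _
      rw [hmem]
      constructor
      · intro h
        exact ⟨(p, if p = ((i : ℤ), (j : ℤ)) then .black else .white), ⟨h.1, h.2, rfl⟩, rfl⟩
      · rintro ⟨x, hx, rfl⟩
        exact ⟨hx.1, hx.2.1⟩
    · rintro p c ⟨h1, h2, h3⟩
      have hp : p ∈ α.dom := (hmem p).2 ⟨h1, h2⟩
      refine ⟨_, hf.apply_of_mem hp, ?_⟩
      simp only at h3
      rw [h3]
      by_cases hpx : p = ((i : ℤ), (j : ℤ))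
      · simp [hpx]
      · rw [if_neg hpx]
        refine if_neg ?_
        intro htile
        refine hpx (huniq p (hf.dom_subset hp) fun d h0 => ?_)
        exact (B.glue_injOn a h0 (congrFun htile d).symm).symm

end Blueprint

end ATAM

/-! ### Reflected plans, and the comb used for small squares. -/

namespace ATAM

/-- The reflection of the sides that exchanges north and south. -/
def Dir.flip : Dir → Dir
  | .north => .south
  | .east => .east
  | .south => .north
  | .west => .west

theorem Dir.flip_flip (d : Dir) : d.flip.flip = d := by cases d <;> rfl

theorem Dir.flip_opp (d : Dir) : d.opp.flip = d.flip.opp := by cases d <;> rfl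

/-- The reflection of the square of side `n` that exchanges its top and its bottom. -/
def flipPos (n : ℕ) (p : Pos) : Pos := (p.1, n - 1 - p.2)

theorem flipPos_flipPos (n : ℕ) (p : Pos) : flipPos n (flipPos n p) = p := by
  ext <;> simp [flipPos]

theorem flipPos_add (n : ℕ) (p : Pos) (d : Dir) :
    flipPos n (p + d.vec) = flipPos n p + d.flip.vec := by
  cases d <;> ext <;> simp [flipPos, Dir.flip, Dir.vec] <;> ring

namespace Blueprint

variable {L : Type}

theorem flipPos_mem_square {n : ℕ} {p : Pos} : flipPos n p ∈ square n ↔ p ∈ square n := by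
  simp only [mem_square, flipPos]
  omega

/-- The plan for the reflected assembly. -/
def flip (B : Blueprint L) (n : ℕ) (hB : B.cells = square n) : Blueprint L where
  cells := B.cells
  seed := flipPos n B.seed
  label p d := B.label (flipPos n p) d.flip
  strength := B.strength
  flow l := (B.flow l).flip
  rank p := B.rank (flipPos n p)
  seed_mem := by rw [hB, flipPos_mem_square, ← hB]; exact B.seed_mem
  label_opp p d := by rw [flipPos_add, Dir.flip_opp, B.label_opp]
  flow_axis p hp d h := by
    rw [hB, ← flipPos_mem_square, ← hB] at hp
    have := B.flow_axis _ hp d.flip h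
    rw [← Dir.flip_opp] at this
    exact this.imp (fun h => by rw [h, Dir.flip_flip]) (fun h => by rw [h, Dir.flip_flip])
  seed_input d h e := by
    rw [flipPos_flipPos] at h e
    exact B.seed_input d.flip h (by rw [← Dir.flip_opp, ← e, Dir.flip_flip])
  sum_input p hp hps := by
    rw [hB, ← flipPos_mem_square, ← hB] at hp
    rw [← B.sum_input _ hp (fun h => hps (by rw [← h, flipPos_flipPos]))]
    refine Fintype.sum_equiv ⟨Dir.flip, Dir.flip, Dir.flip_flip, Dir.flip_flip⟩ _ _ fun d => ?_
    have : ((B.flow (B.label (flipPos n p) d.flip)).flip = d.opp) ↔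
        B.flow (B.label (flipPos n p) d.flip) = d.flip.opp := by
      rw [← Dir.flip_opp]
      constructor
      · intro h; rw [← h, Dir.flip_flip]
      · intro h; rw [h, Dir.flip_flip]
    simp only [this, Equiv.coe_fn_mk]
  input_mem p hp d h0 h1 := by
    rw [hB, ← flipPos_mem_square, ← hB] at hp
    have := B.input_mem _ hp d.flip h0 (by rw [← Dir.flip_opp, ← h1, Dir.flip_flip])
    rw [← flipPos_add] at this
    refine ⟨?_, this.2⟩
    rw [hB, ← flipPos_mem_square, ← hB]
    exact this.1
  determined q hq hqs p h := by
    rw [hB, ← flipPos_mem_square, ← hB] at hq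
    have := B.determined _ hq (fun h => hqs (by rw [← h, flipPos_flipPos])) (flipPos n p) ?_
    · rw [hB, ← flipPos_mem_square, ← hB]
      exact ⟨this.1, fun d => this.2 d.flip⟩
    · intro d h0 h1
      have := h d.flip (by rwa [Dir.flip_flip]) (by rw [Dir.flip_flip, h1, Dir.flip_opp])
      rw [hB, ← flipPos_mem_square, ← hB, flipPos_add, Dir.flip_flip] at this
      exact this

/-- The cell east of `(x, y)` is reached from it along the bottom row. -/
def CombEast (n : ℕ) (p : Pos) : Prop := p.2 = 0 ∧ 0 ≤ p.1 ∧ p.1 + 1 < n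

/-- The cell north of `(x, y)` is reached from it along a column. -/
def CombNorth (n : ℕ) (p : Pos) : Prop := 0 ≤ p.1 ∧ p.1 < n ∧ 0 ≤ p.2 ∧ p.2 + 1 < n

/-- The labels of the sides of the cells, given the labels of their north and east sides. -/
def sideLabel (N E : Pos → L) (p : Pos) : Dir → L
  | .north => N p
  | .east => E p
  | .south => N (p.1, p.2 - 1)
  | .west => E (p.1 - 1, p.2)

theorem sideLabel_opp (N E : Pos → L) (p : Pos) (d : Dir) :
    sideLabel N E (p + d.vec) d.opp = sideLabel N E p d := by
  obtain ⟨x, y⟩ := p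
  cases d <;> simp [sideLabel, Dir.vec, Dir.opp, sub_eq_add_neg]

open Classical in
/-- The labels of a comb, in which every cell has its own tile type. -/
noncomputable def combLabel (n : ℕ) : Pos → Dir → Option (Pos × Bool) :=
  sideLabel (fun p => if CombNorth n p then some (p, true) else none)
    (fun p => if CombEast n p then some (p, false) else none)

theorem eq_of_combLabel_eq {n : ℕ} {p q : Pos} {d : Dir} (h0 : combLabel n q d ≠ none)
    (h : combLabel n p d = combLabel n q d) : p = q := by
  rw [← h] at h0
  obtain ⟨x, y⟩ := p
  obtain ⟨x', y'⟩ := q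
  cases d <;> simp only [combLabel, sideLabel] at h0 h <;> split_ifs at h0 h <;> simp_all

/-- The strength of a label of a comb. -/
def combStrength : Option (Pos × Bool) → ℕ
  | none => 0
  | some _ => 2

/-- The direction of growth of a label of a comb. -/
def combFlow : Option (Pos × Bool) → Dir
  | some (_, true) => .north
  | _ => .east

/-- A plan for the square with a different tile type for every cell. -/
noncomputable def comb (n : ℕ) (hn : 0 < n) : Blueprint (Option (Pos × Bool)) where
  cells := square n
  seed := (0, 0)
  label := combLabel n
  strength := combStrength
  flow := combFlow
  rank p := (p.1 + p.2).toNat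
  seed_mem := by
    rw [mem_square]
    simp [hn]
  label_opp := sideLabel_opp _ _
  flow_axis p _ d h := by
    cases d <;> simp only [combLabel, sideLabel] at h ⊢ <;> split_ifs at h ⊢ <;>
      simp_all [combStrength, combFlow, Dir.opp]
  seed_input d h := by
    cases d <;> simp only [combLabel, sideLabel] at h ⊢ <;> split_ifs at h ⊢ <;>
      simp_all [combStrength, combFlow, Dir.opp, CombNorth, CombEast]
  sum_input p hp hps := by
    obtain ⟨x, y⟩ := p
    rw [mem_square] at hp
    simp only at hp
    have hps : ¬ (x = 0 ∧ y = 0) := fun h => hps (Prod.ext h.1 h.2)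
    rw [Dir.sum_univ]
    by_cases hy : y = 0
    · have h1 : CombEast n (x - 1, y) := by unfold CombEast; simp only; omega
      have h2 : ¬ CombNorth n (x, y - 1) := by unfold CombNorth; simp only; omega
      by_cases h3 : CombNorth n (x, y) <;> by_cases h4 : CombEast n (x, y) <;>
        simp [combLabel, sideLabel, combStrength, combFlow, Dir.opp, h1, h2, h3, h4]
    · have h1 : ¬ CombEast n (x - 1, y) := by unfold CombEast; simp only; omega
      have h2 : CombNorth n (x, y - 1) := by unfold CombNorth; simp only; omega
      by_cases h3 : CombNorth n (x, y) <;> by_cases h4 : CombEast n (x, y) <;>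
        simp [combLabel, sideLabel, combStrength, combFlow, Dir.opp, h1, h2, h3, h4]
  input_mem p hp d h0 h1 := by
    obtain ⟨x, y⟩ := p
    rw [mem_square] at hp ⊢
    cases d <;> simp only [combLabel, sideLabel] at h0 h1 <;> split_ifs at h0 h1 with hc <;>
      simp_all [combStrength, combFlow, Dir.opp, Dir.vec] <;>
      simp only [CombNorth, CombEast] at hc <;> omega
  determined q hq hqs p h := by
    obtain ⟨d, h0, h1⟩ : ∃ d, 0 < combStrength (combLabel n q d) ∧
        combFlow (combLabel n q d) = d.opp := by
      obtain ⟨x, y⟩ := q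
      rw [mem_square] at hq
      simp only at hq
      have hqs : ¬ (x = 0 ∧ y = 0) := fun h => hqs (Prod.ext h.1 h.2)
      by_cases hy : y = 0
      · have h1 : CombEast n (x - 1, y) := by unfold CombEast; simp only; omega
        exact ⟨.west, by simp [combLabel, sideLabel, h1, combStrength, combFlow, Dir.opp]⟩
      · have h2 : CombNorth n (x, y - 1) := by unfold CombNorth; simp only; omega
        exact ⟨.south, by simp [combLabel, sideLabel, h2, combStrength, combFlow, Dir.opp]⟩
    obtain rfl : p = q := eq_of_combLabel_eq
      (by intro hn; rw [hn] at h0; exact absurd h0 (lt_irrefl 0)) (h d h0 h1).2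
    exact ⟨hq, fun _ => rfl⟩

theorem comb_unique {n : ℕ} (hn : 0 < n) {p q : Pos} (hp : p ∈ square n) (hq : q ∈ square n)
    (h : ∀ d, 0 < (comb n hn).strength ((comb n hn).label q d) →
      (comb n hn).label p d = (comb n hn).label q d) : p = q := by
  rw [mem_square] at hp hq
  by_cases h1 : CombNorth n q
  · have hl : combLabel n q .north = some (q, true) := by simp [combLabel, sideLabel, h1]
    refine eq_of_combLabel_eq (d := .north) (by simp [hl]) (h .north ?_)
    change 0 < combStrength (combLabel n q .north)
    simp [hl, combStrength]
  by_cases h2 : CombNorth n (q.1, q.2 - 1)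
  · have hl : combLabel n q .south = some ((q.1, q.2 - 1), true) := by simp [combLabel, sideLabel, h2]
    refine eq_of_combLabel_eq (d := .south) (by simp [hl]) (h .south ?_)
    change 0 < combStrength (combLabel n q .south)
    simp [hl, combStrength]
  -- Without a neighbour in its column, the cell fills a square of side 1.
  simp only [CombNorth] at h1 h2
  ext <;> omega

end Blueprint

end ATAM

/-! ### Binary digits and the labels of the counter. -/

namespace ATAM

namespace Counter

/-- The `y` low bits of `z` vanish. -/
def LowZero (y z : ℤ) : Prop := (2 : ℤ) ^ y.toNat ∣ z

instance (y z : ℤ) : Decidable (LowZero y z) := inferInstanceAs (Decidable (_ ∣ _))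

/-- Bit `y` of `z`. -/
def bit (y z : ℤ) : Bool := decide (z / 2 ^ y.toNat % 2 = 1)

theorem lowZero_zero (z : ℤ) : LowZero 0 z := by simp [LowZero]

theorem LowZero.pred {y z : ℤ} (h : LowZero (y + 1) z) : LowZero y z :=
  (pow_dvd_pow 2 (by omega)).trans h

theorem LowZero.congr {y z w : ℤ} (h : LowZero y (z - w)) : LowZero y z ↔ LowZero y w :=
  dvd_iff_dvd_of_dvd_sub h

/-- This lets a growing column compare its number with a constant c: the new flag depends only on
the old flag and on the next digit. -/
theorem lowZero_succ_sub {y : ℤ} (hy : 0 ≤ y) (z c : ℤ) :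
    LowZero (y + 1) (z - c) ↔ LowZero y (z - c) ∧ bit y z = bit y c := by
  have hpos : (0 : ℤ) < 2 ^ y.toNat := by positivity
  have hs : (y + 1).toNat = y.toNat + 1 := by omega
  unfold LowZero bit
  rw [hs, pow_succ, decide_eq_decide]
  generalize (2 : ℤ) ^ y.toNat = P at hpos
  constructor
  · rintro ⟨m, hm⟩
    refine ⟨⟨2 * m, by rw [hm]; ring⟩, ?_⟩
    have hz : z = c + P * (2 * m) := by linarith
    rw [hz, Int.add_mul_ediv_left _ _ hpos.ne']
    omega
  · rintro ⟨⟨m, hm⟩, hb⟩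
    have hz : z = c + P * m := by linarith
    rw [hz, Int.add_mul_ediv_left _ _ hpos.ne'] at hb
    obtain ⟨l, rfl⟩ : (2 : ℤ) ∣ m := by omega
    exact ⟨l, by rw [hm]; ring⟩

/-- The borrow is absorbed by a set bit below y. -/
theorem bit_sub_one {y z : ℤ} (h : ¬ LowZero y z) : bit y (z - 1) = bit y z := by
  have hpos : (0 : ℤ) < 2 ^ y.toNat := by positivity
  unfold LowZero at h
  unfold bit
  generalize (2 : ℤ) ^ y.toNat = P at hpos h
  have h1 := Int.emod_add_mul_ediv z P
  have h2 := Int.emod_nonneg z hpos.ne'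
  have h3 := Int.emod_lt_of_pos z hpos
  have h4 : z % P ≠ 0 := fun h0 => h (Int.dvd_of_emod_eq_zero h0)
  have h5 : (z - 1) / P = z / P := by
    have : z - 1 = (z % P - 1) + P * (z / P) := by linarith
    rw [this, Int.add_mul_ediv_left _ _ hpos.ne', Int.ediv_eq_zero_of_lt (by omega) (by omega)]
    simp
  rw [h5]

/-- A number whose `y` low bits vanish but not bit `y`. -/
theorem lowZero_sub_of_not {y z w : ℤ} (hy : 0 ≤ y) (hz : LowZero y z) (hz' : ¬ LowZero (y + 1) z)
    (hw : LowZero y w) (hw' : ¬ LowZero (y + 1) w) : LowZero (y + 1) (z - w) := by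
  have e1 := lowZero_succ_sub hy z 0
  have e2 := lowZero_succ_sub hy w 0
  rw [sub_zero] at e1 e2
  rw [lowZero_succ_sub hy]
  refine ⟨dvd_sub hz hw, ?_⟩
  have h1 : bit y z ≠ bit y 0 := fun h => hz' (e1.2 ⟨hz, h⟩)
  have h2 : bit y w ≠ bit y 0 := fun h => hw' (e2.2 ⟨hw, h⟩)
  revert h1 h2
  cases bit y z <;> cases bit y w <;> cases bit y 0 <;> simp

theorem lowZero_iff_eq_zero {y z : ℤ} (h : |z| < 2 ^ y.toNat) : LowZero y z ↔ z = 0 :=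
  ⟨fun hd => Int.eq_zero_of_abs_lt_dvd hd h, fun hz => hz ▸ dvd_zero _⟩

/-- The kinds of labels. Below row `k`, columns hold the digits of a binary counter: `start` builds
the first column, `strong` and `down` start a new column, `digit` and `agree` extend it upwards.
Above, `up`, `east` and `west` mark a diagonal and the row and the column of the pixel. -/
inductive Shape
  | null
  | start
  | down
  | strong
  | digit (b : Bool)
  | agree (e a b c : Bool)
  | up (s a b : Bool)
  | east (s a : Bool)
  | west (a : Bool)
  deriving DecidableEq, Fintype

/-- The strength of a label. -/
def Shape.strength : Shape → ℕ
  | .null => 0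
  | .start => 2
  | .down => 2
  | .strong => 2
  | .up true _ _ => 2
  | _ => 1

/-- The direction of growth of a label. -/
def Shape.flow : Shape → Dir
  | .down => .south
  | .strong => .east
  | .digit _ => .east
  | .east _ _ => .east
  | .west _ => .west
  | _ => .north

/-- The label between a cell and its northern neighbour. -/
def northShape (n k i j : ℤ) (p : Pos) : Shape :=
  if p.2 < 0 then .null
  else if p.2 < k - 1 then
    if p.1 = 0 then .start
    -- This row lies below the lowest set bit of n - x, so it is reached from above.
    else if LowZero (p.2 + 1) (n - p.1) then .down
    -- The flags compare the outgoing number n - x - 1 with n - 1 - c in the bits up to this row;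
    -- agreement in all k bits means x = c. The flag for 0 tells whether a set bit has occurred so
    -- far.
    else .agree (decide (LowZero (p.2 + 1) (n - p.1 - 1 - 0)))
      (decide (LowZero (p.2 + 1) (n - p.1 - 1 - (n - 1 - k))))
      (decide (LowZero (p.2 + 1) (n - p.1 - 1 - (n - 1 - i))))
      (decide (LowZero (p.2 + 1) (n - p.1 - 1 - (n - 1 - j))))
  -- The first mark announces that the cell above lies on the diagonal.
  else .up (decide (p.1 = p.2 + 1)) (decide (p.1 = i)) (decide (p.1 = j))

/-- The label between a cell and its eastern neighbour. -/
def eastShape (n k j : ℤ) (p : Pos) : Shape :=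
  if p.2 < k then
    if p.1 < 0 then .null
    -- Zeros below the lowest set bit are not sent; the next column recovers them by growing down.
    else if LowZero (p.2 + 1) (n - p.1 - 1) then .null
    else if LowZero p.2 (n - p.1 - 1) then .strong
    else .digit (bit p.2 (n - p.1 - 1))
  -- The first mark is set just east of the diagonal, where the next cell has to send the diagonal
  -- on upwards.
  else if p.2 ≤ p.1 then .east (decide (p.1 = p.2)) (decide (p.2 = j))
  else .west (decide (p.2 = j))

variable {n k i j : ℤ} {p q : Pos}

theorem northShape_eq_start :
    northShape n k i j p = .start ↔ 0 ≤ p.2 ∧ p.2 < k - 1 ∧ p.1 = 0 := by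
  unfold northShape
  split_ifs <;> simp <;> omega

theorem northShape_eq_down :
    northShape n k i j p = .down ↔
      0 ≤ p.2 ∧ p.2 < k - 1 ∧ p.1 ≠ 0 ∧ LowZero (p.2 + 1) (n - p.1) := by
  unfold northShape
  split_ifs <;> simp_all

theorem northShape_eq_agree {e a b c : Bool} :
    northShape n k i j p = .agree e a b c ↔
      0 ≤ p.2 ∧ p.2 < k - 1 ∧ p.1 ≠ 0 ∧ ¬ LowZero (p.2 + 1) (n - p.1) ∧
      decide (LowZero (p.2 + 1) (n - p.1 - 1 - 0)) = e ∧
      decide (LowZero (p.2 + 1) (n - p.1 - 1 - (n - 1 - k))) = a ∧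
      decide (LowZero (p.2 + 1) (n - p.1 - 1 - (n - 1 - i))) = b ∧
      decide (LowZero (p.2 + 1) (n - p.1 - 1 - (n - 1 - j))) = c := by
  unfold northShape
  split_ifs with h1 h2 h3 h4 <;> simp only [Shape.agree.injEq, false_iff, not_and]
  · omega
  · omega
  · tauto
  · simp only [h2, h3, h4, not_lt.1 h1, not_false_eq_true, ne_eq, true_and]
  · omega

theorem northShape_eq_up (hk : 1 ≤ k) {s a b : Bool} :
    northShape n k i j p = .up s a b ↔
      k - 1 ≤ p.2 ∧ decide (p.1 = p.2 + 1) = s ∧ decide (p.1 = i) = a ∧ decide (p.1 = j) = b := by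
  unfold northShape
  split_ifs with h1 h2 h3 h4 <;> simp only [Shape.up.injEq, false_iff, not_and]
  · omega
  · omega
  · omega
  · omega
  · simp only [not_lt.1 h2, true_and]

theorem eastShape_eq_strong :
    eastShape n k j p = .strong ↔
      p.2 < k ∧ 0 ≤ p.1 ∧ ¬ LowZero (p.2 + 1) (n - p.1 - 1) ∧ LowZero p.2 (n - p.1 - 1) := by
  unfold eastShape
  split_ifs <;> simp_all

theorem eastShape_eq_digit {b : Bool} :
    eastShape n k j p = .digit b ↔
      p.2 < k ∧ 0 ≤ p.1 ∧ ¬ LowZero p.2 (n - p.1 - 1) ∧ bit p.2 (n - p.1 - 1) = b := by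
  unfold eastShape
  split_ifs with h1 h2 h3 h4 <;> simp only [Shape.digit.injEq, false_iff, not_and]
  · omega
  · intro _ _ h; exact absurd h3.pred h
  · intro _ _ h; exact absurd h4 h
  · simp only [h1, not_lt.1 h2, h4, not_false_eq_true, true_and]
  · intro h; exact absurd h h1
  · intro h; exact absurd h h1

theorem eastShape_eq_east {s a : Bool} :
    eastShape n k j p = .east s a ↔
      k ≤ p.2 ∧ p.2 ≤ p.1 ∧ decide (p.1 = p.2) = s ∧ decide (p.2 = j) = a := by
  unfold eastShape
  split_ifs with h1 h2 h3 h4 h5 <;> simp only [Shape.east.injEq, false_iff, not_and]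
  any_goals omega
  simp only [not_lt.1 h1, h5, true_and]

theorem eastShape_eq_west {a : Bool} :
    eastShape n k j p = .west a ↔ k ≤ p.2 ∧ p.1 < p.2 ∧ decide (p.2 = j) = a := by
  unfold eastShape
  split_ifs with h1 h2 h3 h4 h5 <;> simp only [Shape.west.injEq, false_iff, not_and]
  any_goals omega
  simp only [not_lt.1 h1, not_le.1 h5, true_and]

end Counter

end ATAM

/-! ### Inputs of the cells and the order of growth. -/

namespace ATAM

namespace Counter

open Blueprint

/-- The labels of the sides of the cells. Labels below row `k` carry the number of their row. -/
def label (n k i j : ℤ) : Pos → Dir → Shape × ℤ :=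
  sideLabel (fun p => (northShape n k i j p, min p.2 (k - 1)))
    (fun p => (eastShape n k j p, min p.2 k))

/-- The strength with which growth enters the cell `p` at the side `d`. -/
def inputStrength (n k i j : ℤ) (p : Pos) (d : Dir) : ℕ :=
  if (label n k i j p d).1.flow = d.opp then (label n k i j p d).1.strength else 0

variable {n k i j : ℤ} {p q : Pos}

theorem inputStrength_pos {d : Dir} (h0 : 0 < (label n k i j p d).1.strength)
    (h1 : (label n k i j p d).1.flow = d.opp) : 0 < inputStrength n k i j p d := by
  rwa [inputStrength, if_pos h1]

theorem input_of_inputStrength_pos {d : Dir} (h : 0 < inputStrength n k i j p d) :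
    0 < (label n k i j p d).1.strength ∧ (label n k i j p d).1.flow = d.opp := by
  unfold inputStrength at h
  by_cases h1 : (label n k i j p d).1.flow = d.opp
  · rw [if_pos h1] at h
    exact ⟨h, h1⟩
  · rw [if_neg h1] at h
    exact absurd h (lt_irrefl 0)

theorem inputStrength_north :
    inputStrength n k i j p .north = if northShape n k i j p = .down then 2 else 0 := by
  have h : ∀ s : Shape, (if s.flow = .south then s.strength else 0) =
      if s = .down then 2 else 0 := by
    intro s
    cases s <;> simp [Shape.flow, Shape.strength]
  exact h _

theorem inputStrength_east :
    inputStrength n k i j p .east = if k ≤ p.2 ∧ p.1 < p.2 then 1 else 0 := by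
  change (if (eastShape n k j p).flow = .west then (eastShape n k j p).strength else 0) = _
  split_ifs with h1 h2 h2
  · rw [(eastShape_eq_west (a := decide (p.2 = j))).2 ⟨h2.1, h2.2, rfl⟩]
    rfl
  · exfalso
    unfold eastShape at h1
    split_ifs at h1 <;> first
      | exact Dir.noConfusion h1
      | omega
  · rw [(eastShape_eq_west (a := decide (p.2 = j))).2 ⟨h2.1, h2.2, rfl⟩] at h1
    exact absurd rfl h1
  · rfl

theorem inputStrength_south_of_start (h : 0 < p.2 ∧ p.2 < k ∧ p.1 = 0) :
    inputStrength n k i j p .south = 2 := by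
  have e : northShape n k i j (p.1, p.2 - 1) = .start := by
    rw [northShape_eq_start]
    simp only
    omega
  simp [inputStrength, label, sideLabel, e, Shape.flow, Shape.strength, Dir.opp]

theorem inputStrength_south_of_neg (h : p.2 = 0) : inputStrength n k i j p .south = 0 := by
  simp [inputStrength, label, sideLabel, northShape, h, Shape.flow, Shape.strength, Dir.opp]

theorem inputStrength_south_of_down (h : 0 < p.2 ∧ p.2 < k ∧ p.1 ≠ 0)
    (hz : LowZero p.2 (n - p.1)) : inputStrength n k i j p .south = 0 := by
  have e : northShape n k i j (p.1, p.2 - 1) = .down := by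
    rw [northShape_eq_down]
    simp only [sub_add_cancel]
    exact ⟨by omega, by omega, h.2.2, hz⟩
  simp [inputStrength, label, sideLabel, e, Shape.flow, Dir.opp]

theorem inputStrength_south_of_agree (h : 0 < p.2 ∧ p.2 < k ∧ p.1 ≠ 0)
    (hz : ¬ LowZero p.2 (n - p.1)) : inputStrength n k i j p .south = 1 := by
  obtain ⟨e, a, b, c, he⟩ : ∃ e a b c, northShape n k i j (p.1, p.2 - 1) = .agree e a b c := by
    refine ⟨_, _, _, _, northShape_eq_agree.2
      ⟨?_, ?_, h.2.2, ?_, rfl, rfl, rfl, rfl⟩⟩ <;> simp only [sub_add_cancel]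
    · omega
    · omega
    · exact hz
  simp [inputStrength, label, sideLabel, he, Shape.flow, Shape.strength, Dir.opp]

theorem inputStrength_south_of_up (hk : 1 ≤ k) (h : k ≤ p.2) :
    inputStrength n k i j p .south = if p.1 = p.2 then 2 else 1 := by
  have e : northShape n k i j (p.1, p.2 - 1) =
      .up (decide (p.1 = p.2)) (decide (p.1 = i)) (decide (p.1 = j)) := by
    rw [northShape_eq_up hk]
    simp only [sub_add_cancel, and_true]
    omega
  simp only [inputStrength, label, sideLabel, e, Shape.flow, Dir.opp]
  by_cases hp : p.1 = p.2 <;> simp [hp, Shape.strength]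

theorem inputStrength_west_of_lt (h : p.2 < k) :
    inputStrength n k i j p .west =
      if p.1 < 1 ∨ LowZero (p.2 + 1) (n - p.1) then 0
      else if LowZero p.2 (n - p.1) then 2 else 1 := by
  have e : n - (p.1 - 1) - 1 = n - p.1 := by ring
  simp only [inputStrength, label, sideLabel, eastShape, h, if_true, e, sub_neg]
  by_cases h1 : p.1 < 1
  · simp [h1, Shape.strength]
  by_cases h2 : LowZero (p.2 + 1) (n - p.1)
  · simp [h2, Shape.strength]
  by_cases h3 : LowZero p.2 (n - p.1) <;>
    simp [h1, h2, h3, Shape.strength, Shape.flow, Dir.opp]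

theorem inputStrength_west_of_le (h : k ≤ p.2) :
    inputStrength n k i j p .west = if p.2 < p.1 then 1 else 0 := by
  have e : p.2 ≤ p.1 - 1 ↔ p.2 < p.1 := by omega
  simp only [inputStrength, label, sideLabel, eastShape, not_lt.2 h, if_false, e]
  split_ifs <;> simp_all [Shape.strength, Shape.flow, Dir.opp]

/-- The sizes for which the counter of `k` digits can count the columns of the square. -/
structure Fits (n k i j : ℤ) : Prop where
  one_le : 1 ≤ k
  lt : k < n
  le_pow : n ≤ 2 ^ k.toNat
  i_nonneg : 0 ≤ i
  i_lt : i < n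
  j_nonneg : 0 ≤ j
  j_lt : j < n

theorem Fits.not_lowZero (h : Fits n k i j) {y z : ℤ} (hy : k ≤ y) (h0 : 0 < z) (hz : z < n) :
    ¬ LowZero y z := by
  intro hd
  have hd' : LowZero k z := (pow_dvd_pow 2 (by omega)).trans hd
  rw [lowZero_iff_eq_zero (by rw [abs_of_pos h0]; exact hz.trans_le h.le_pow)] at hd'
  omega

/-- The difference is c - x, which is less than 2 ^ k in absolute value. -/
theorem Fits.lowZero_iff (h : Fits n k i j) {x c : ℤ} (hx : 0 ≤ x ∧ x < n) (hc : 0 ≤ c ∧ c < n) :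
    LowZero k (n - x - 1 - (n - 1 - c)) ↔ x = c := by
  rw [lowZero_iff_eq_zero]
  · omega
  · refine lt_of_lt_of_le ?_ h.le_pow
    rw [abs_lt]
    omega

/-- The possible inputs of a cell. -/
inductive Kind (n k i j : ℤ) (p : Pos) : Prop
  | seed (h : p.1 = 0 ∧ p.2 = 0)
      (hN : inputStrength n k i j p .north = 0) (hE : inputStrength n k i j p .east = 0)
      (hS : inputStrength n k i j p .south = 0) (hW : inputStrength n k i j p .west = 0)
  | start (h : p.1 = 0 ∧ 0 < p.2 ∧ p.2 < k)
      (hN : inputStrength n k i j p .north = 0) (hE : inputStrength n k i j p .east = 0)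
      (hS : inputStrength n k i j p .south = 2) (hW : inputStrength n k i j p .west = 0)
  | down (h : 0 < p.1 ∧ p.2 < k - 1) (hz : LowZero (p.2 + 1) (n - p.1))
      (hN : inputStrength n k i j p .north = 2) (hE : inputStrength n k i j p .east = 0)
      (hS : inputStrength n k i j p .south = 0) (hW : inputStrength n k i j p .west = 0)
  | strong (h : 0 < p.1 ∧ p.2 < k) (hz : LowZero p.2 (n - p.1))
      (hz' : ¬ LowZero (p.2 + 1) (n - p.1))
      (hN : inputStrength n k i j p .north = 0) (hE : inputStrength n k i j p .east = 0)
      (hS : inputStrength n k i j p .south = 0) (hW : inputStrength n k i j p .west = 2)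
  | digit (h : 0 < p.1 ∧ 0 < p.2 ∧ p.2 < k) (hz : ¬ LowZero p.2 (n - p.1))
      (hN : inputStrength n k i j p .north = 0) (hE : inputStrength n k i j p .east = 0)
      (hS : inputStrength n k i j p .south = 1) (hW : inputStrength n k i j p .west = 1)
  | diagonal (h : k ≤ p.2 ∧ p.1 = p.2)
      (hN : inputStrength n k i j p .north = 0) (hE : inputStrength n k i j p .east = 0)
      (hS : inputStrength n k i j p .south = 2) (hW : inputStrength n k i j p .west = 0)
  | right (h : k ≤ p.2 ∧ p.2 < p.1)
      (hN : inputStrength n k i j p .north = 0) (hE : inputStrength n k i j p .east = 0)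
      (hS : inputStrength n k i j p .south = 1) (hW : inputStrength n k i j p .west = 1)
  | left (h : k ≤ p.2 ∧ p.1 < p.2)
      (hN : inputStrength n k i j p .north = 0) (hE : inputStrength n k i j p .east = 1)
      (hS : inputStrength n k i j p .south = 1) (hW : inputStrength n k i j p .west = 0)

/-- In the counter, past column 0, the case is decided by the position of the row relative to the
lowest set bit of n - x; above the counter, by the side of the diagonal. -/
theorem Fits.kind (h : Fits n k i j) (hp : (0 ≤ p.1 ∧ p.1 < n) ∧ (0 ≤ p.2 ∧ p.2 < n)) :
    Kind n k i j p := by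
  have hk := h.one_le
  have hN : ¬ (p.2 < k - 1 ∧ p.1 ≠ 0 ∧ LowZero (p.2 + 1) (n - p.1)) →
      inputStrength n k i j p .north = 0 := fun hn => by
    rw [inputStrength_north, if_neg]
    exact fun hd => hn (northShape_eq_down.1 hd).2
  by_cases hy : p.2 < k
  · have hE : inputStrength n k i j p .east = 0 := by
      rw [inputStrength_east, if_neg (by omega)]
    have hW := @inputStrength_west_of_lt n k i j p hy
    by_cases hx : p.1 = 0
    · rw [if_pos (by omega)] at hW
      by_cases hy0 : p.2 = 0
      · exact .seed ⟨hx, hy0⟩ (hN (by tauto)) hE (inputStrength_south_of_neg hy0) hW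
      · exact .start ⟨hx, by omega, hy⟩ (hN (by tauto)) hE
          (inputStrength_south_of_start ⟨by omega, hy, hx⟩) hW
    have hS : LowZero p.2 (n - p.1) → inputStrength n k i j p .south = 0 := fun hz => by
      by_cases hy0 : p.2 = 0
      · exact inputStrength_south_of_neg hy0
      · exact inputStrength_south_of_down ⟨by omega, hy, hx⟩ hz
    by_cases hz : LowZero (p.2 + 1) (n - p.1)
    -- Since 0 < n - x < 2 ^ k, the number has a set bit within the k rows, so no cell of the top
    -- row is entered from above.
    · have hy' : p.2 < k - 1 := by
        by_contra hcon
        exact h.not_lowZero (by omega) (by omega) (by omega) hz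
      rw [if_pos (Or.inr hz)] at hW
      refine .down ⟨by omega, hy'⟩ hz ?_ hE (hS hz.pred) hW
      rw [inputStrength_north, if_pos (northShape_eq_down.2 ⟨hp.2.1, hy', hx, hz⟩)]
    · have hor : ¬ (p.1 < 1 ∨ LowZero (p.2 + 1) (n - p.1)) := by
        rintro (h1 | h1)
        · omega
        · exact hz h1
      rw [if_neg hor] at hW
      by_cases hz' : LowZero p.2 (n - p.1)
      · rw [if_pos hz'] at hW
        exact .strong ⟨by omega, hy⟩ hz' hz (hN (by tauto)) hE (hS hz') hW
      · rw [if_neg hz'] at hW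
        have hy0 : p.2 ≠ 0 := fun h0 => hz' (h0 ▸ lowZero_zero _)
        exact .digit ⟨by omega, by omega, hy⟩ hz' (hN (by tauto)) hE
          (inputStrength_south_of_agree ⟨by omega, hy, hx⟩ hz') hW
  · have hy' : k ≤ p.2 := not_lt.1 hy
    have hN := hN (by omega)
    have hS := @inputStrength_south_of_up n k i j p hk hy'
    have hW := @inputStrength_west_of_le n k i j p hy'
    have hE := @inputStrength_east n k i j p
    rcases lt_trichotomy p.1 p.2 with hlt | heq | hgt
    · rw [if_neg (by omega)] at hS hW
      rw [if_pos (by omega)] at hE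
      exact .left ⟨hy', hlt⟩ hN hE hS hW
    · rw [if_pos heq] at hS
      rw [if_neg (by omega)] at hW hE
      exact .diagonal ⟨hy', heq⟩ hN hE hS hW
    · rw [if_neg (by omega)] at hS hE
      rw [if_pos (by omega)] at hW
      exact .right ⟨hy', hgt⟩ hN hE hS hW

theorem flow_axis (d : Dir) (h : 0 < (label n k i j p d).1.strength) :
    (label n k i j p d).1.flow = d ∨ (label n k i j p d).1.flow = d.opp := by
  cases d <;> simp only [label, sideLabel, northShape, eastShape] at h ⊢ <;>
    split_ifs at h ⊢ <;> simp_all [Shape.flow, Shape.strength, Dir.opp]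

/-- An order of growth. -/
def rank (n k : ℤ) (p : Pos) : ℤ :=
  if p.2 < k then
    -- Each column has a block of 2k + 1 ranks. Past column 0, growth starts at the lowest set bit,
    -- first down with ranks k - y, then up with ranks k + y.
    p.1 * (2 * k + 1) +
      (if p.1 = 0 then p.2 else if LowZero p.2 (n - p.1) then k - p.2 else k + p.2)
  -- After the counter: row by row, each outwards from the diagonal.
  else n * (2 * k + 1) + p.2 * n + |p.1 - p.2|

theorem rank_of_lt (hp : (0 ≤ p.1 ∧ p.1 < n) ∧ (0 ≤ p.2 ∧ p.2 < k)) :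
    p.1 * (2 * k + 1) ≤ rank n k p ∧ rank n k p ≤ p.1 * (2 * k + 1) + 2 * k := by
  unfold rank
  rw [if_pos hp.2.2]
  split_ifs <;> constructor <;> linarith

theorem Fits.input_mem (h : Fits n k i j) (hp : (0 ≤ p.1 ∧ p.1 < n) ∧ (0 ≤ p.2 ∧ p.2 < n)) (d : Dir)
    (hd : 0 < inputStrength n k i j p d) :
    ((0 ≤ (p + d.vec).1 ∧ (p + d.vec).1 < n) ∧ (0 ≤ (p + d.vec).2 ∧ (p + d.vec).2 < n)) ∧
      0 ≤ rank n k (p + d.vec) ∧ rank n k (p + d.vec) < rank n k p := by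
  have hk := h.one_le
  have hkn := h.lt
  obtain ⟨x, y⟩ := p
  have hnonneg : ∀ q : Pos, ((0 ≤ q.1 ∧ q.1 < n) ∧ (0 ≤ q.2 ∧ q.2 < n)) → 0 ≤ rank n k q := by
    rintro q hq
    by_cases hy : q.2 < k
    · refine le_trans ?_ (rank_of_lt (n := n) ⟨hq.1, hq.2.1, hy⟩).1
      have := hq.1.1
      positivity
    · unfold rank
      rw [if_neg hy]
      have := hq.2.1
      have : 0 ≤ n := by omega
      have : 0 ≤ k := by omega
      positivity
  suffices hs : ((0 ≤ ((x, y) + d.vec).1 ∧ ((x, y) + d.vec).1 < n) ∧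
      (0 ≤ ((x, y) + d.vec).2 ∧ ((x, y) + d.vec).2 < n)) ∧
      rank n k ((x, y) + d.vec) < rank n k (x, y) from ⟨hs.1, hnonneg _ hs.1, hs.2⟩
  have hW : 0 < x → y < k → rank n k (x - 1, y) < rank n k (x, y) := fun h1 h2 => by
    have e1 := (rank_of_lt (n := n) (k := k) (p := (x - 1, y))
      ⟨⟨by simp only; omega, by simp only; omega⟩, hp.2.1, h2⟩).2
    have e2 := (rank_of_lt (n := n) (k := k) (p := (x, y)) ⟨hp.1, hp.2.1, h2⟩).1
    simp only at e1 e2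
    linarith
  have hS : k ≤ y → rank n k (x, y - 1) < rank n k (x, y) := fun h1 => by
    by_cases h2 : y - 1 < k
    · have e1 := (rank_of_lt (n := n) (k := k) (p := (x, y - 1))
        ⟨hp.1, by simp only; omega, h2⟩).2
      have e2 : (x + 1) * (2 * k + 1) ≤ n * (2 * k + 1) :=
        mul_le_mul_of_nonneg_right (by have := hp.1.2; simp only at this; omega) (by omega)
      have e3 : 0 ≤ y * n + |x - y| :=
        add_nonneg (mul_nonneg (by omega) (by omega)) (abs_nonneg _)
      simp only at e1
      rw [show rank n k (x, y) = n * (2 * k + 1) + y * n + |x - y| from if_neg (not_lt.2 h1)]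
      linarith
    · rw [show rank n k (x, y) = n * (2 * k + 1) + y * n + |x - y| from if_neg (not_lt.2 h1),
        show rank n k (x, y - 1) = n * (2 * k + 1) + (y - 1) * n + |x - (y - 1)| from if_neg h2]
      have e1 : |x - (y - 1)| < n + |x - y| := by
        have e2 : |x - (y - 1)| ≤ |x - y| + |1| := by
          rw [show x - (y - 1) = x - y + 1 by ring]
          exact abs_add_le _ _
        rw [abs_one] at e2
        linarith
      linarith
  simp only at hp
  -- Sides with no input contradict `hd`; ten pairs of a kind and an input side remain.
  rcases h.kind (p := (x, y)) hp with ⟨h1, hN, hE, hS', hW'⟩ | ⟨h1, hN, hE, hS', hW'⟩ |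
    ⟨h1, hz, hN, hE, hS', hW'⟩ | ⟨h1, hz, hz', hN, hE, hS', hW'⟩ | ⟨h1, hz, hN, hE, hS', hW'⟩ |
    ⟨h1, hN, hE, hS', hW'⟩ | ⟨h1, hN, hE, hS', hW'⟩ | ⟨h1, hN, hE, hS', hW'⟩ <;>
  simp only at h1 <;> cases d <;> first
    | (exfalso; omega)
    | simp only [Dir.vec, Prod.mk_add_mk, add_zero, ← sub_eq_add_neg]
  · refine ⟨by omega, ?_⟩
    obtain rfl := h1.1
    simp only [rank, if_pos h1.2.2, if_pos (show y - 1 < k by omega), if_true]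
    omega
  · refine ⟨by omega, ?_⟩
    simp only [rank, if_pos (show y < k by omega), if_pos (show y + 1 < k by omega),
      if_neg (show x ≠ 0 by omega), if_pos hz, if_pos hz.pred]
    omega
  · exact ⟨by omega, hW h1.1 h1.2⟩
  · refine ⟨by omega, ?_⟩
    simp only at hz
    simp only [rank, if_pos h1.2.2, if_pos (show y - 1 < k by omega),
      if_neg (show x ≠ 0 by omega), if_neg hz]
    split_ifs <;> omega
  · exact ⟨by omega, hW h1.1 h1.2.2⟩
  · exact ⟨by omega, hS h1.1⟩
  · exact ⟨by omega, hS h1.1⟩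
  · refine ⟨by omega, ?_⟩
    simp only [rank, if_neg (not_lt.2 h1.1)]
    rw [abs_of_nonneg (by omega), abs_of_nonneg (by omega)]
    omega
  · refine ⟨by omega, ?_⟩
    simp only [rank, if_neg (not_lt.2 h1.1)]
    rw [abs_of_nonpos (by omega), abs_of_nonpos (by omega)]
    omega
  · exact ⟨by omega, hS h1.1⟩

end Counter

end ATAM

/-! ### The inputs determine the tile, and the pixel is unique. -/

namespace ATAM

namespace Counter

open Blueprint

variable {n k i j : ℤ} {p q : Pos}

/-- Row numbers are cut off above the counter, so cells there can be compared across different rows.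
-/
theorem label_ext (hy : p.2 = q.2 ∨ k ≤ p.2 ∧ k ≤ q.2)
    (hN : northShape n k i j p = northShape n k i j q) (hE : eastShape n k j p = eastShape n k j q)
    (hS : northShape n k i j (p.1, p.2 - 1) = northShape n k i j (q.1, q.2 - 1))
    (hW : eastShape n k j (p.1 - 1, p.2) = eastShape n k j (q.1 - 1, q.2)) (d : Dir) :
    label n k i j p d = label n k i j q d := by
  cases d <;> simp only [label, sideLabel, Prod.mk.injEq]
  · exact ⟨hN, by omega⟩
  · exact ⟨hE, by omega⟩
  · exact ⟨hS, by omega⟩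
  · exact ⟨hW, by omega⟩

/-- Past column 0, the shape depends on n - x only modulo 2 ^ (y + 1). -/
theorem northShape_congr {x x' y : ℤ} (hx : x ≠ 0) (hx' : x' ≠ 0) (hy : y < k - 1)
    (h : 0 ≤ y → LowZero (y + 1) (n - x - (n - x'))) :
    northShape n k i j (x, y) = northShape n k i j (x', y) := by
  unfold northShape
  by_cases h0 : y < 0
  · simp [h0]
  have h := h (not_lt.1 h0)
  have hc : ∀ c, LowZero (y + 1) (n - x - 1 - c) ↔ LowZero (y + 1) (n - x' - 1 - c) := fun c =>
    LowZero.congr (by rwa [show n - x - 1 - c - (n - x' - 1 - c) = n - x - (n - x') by ring])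
  simp only [h0, hy, hx, hx', if_false, if_true, hc, h.congr]

theorem eastShape_congr {x x' y : ℤ} (hx : 0 ≤ x) (hx' : 0 ≤ x') (hy : 0 ≤ y) (hyk : y < k)
    (h : LowZero (y + 1) (n - x - (n - x'))) :
    eastShape n k j (x, y) = eastShape n k j (x', y) := by
  have h' : LowZero (y + 1) (n - x - 1 - (n - x' - 1)) := by
    rwa [show n - x - 1 - (n - x' - 1) = n - x - (n - x') by ring]
  unfold eastShape
  simp only [hyk, if_true, not_lt.2 hx, not_lt.2 hx', if_false, h'.congr, h'.pred.congr,
    ((lowZero_succ_sub hy _ _).1 h').2]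

/-- Two columns of the counter agree up to row `y` if their numbers agree in the bits up to `y`. -/
theorem Fits.label_congr (h : Fits n k i j) {x x' y : ℤ} (hx : 0 < x ∧ x < n)
    (hx' : 0 < x' ∧ x' < n) (hy : 0 ≤ y) (hyk : y < k)
    (hz : LowZero (y + 1) (n - x - (n - x'))) (d : Dir) :
    label n k i j (x, y) d = label n k i j (x', y) d := by
  by_cases hk : y < k - 1
  · refine label_ext (p := (x, y)) (q := (x', y)) (Or.inl rfl) (northShape_congr (by omega) (by omega) hk fun _ => hz)
      (eastShape_congr (by omega) (by omega) hy hyk hz)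
      (northShape_congr (by omega) (by omega) (show y - 1 < k - 1 by omega) fun _ => ?_)
      (eastShape_congr (by simp only; omega) (by simp only; omega) hy hyk ?_) d
    · simp only [sub_add_cancel]
      exact hz.pred
    · rwa [show n - (x - 1) - (n - (x' - 1)) = n - x - (n - x') by ring]
  -- In the top row all k bits agree, so the columns coincide.
  · have hyk' : y + 1 = k := by omega
    rw [hyk', lowZero_iff_eq_zero] at hz
    · rw [show x = x' by omega]
    · refine lt_of_lt_of_le ?_ h.le_pow
      rw [abs_lt]
      omega

/-- Above the lowest set bit the digit passes unchanged by `bit_sub_one`, and it turns the southern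
flags into the northern ones by `lowZero_succ_sub`. In the top row the last three flags become x =
k, x = i and x = j. -/
theorem Fits.determined_digit (h : Fits n k i j) {x x' y : ℤ} (hx : 0 < x ∧ x < n)
    (hx' : 0 < x' ∧ x' < n) (hy : 0 < y) (hyk : y < k)
    (hz : ¬ LowZero y (n - x'))
    (hS : northShape n k i j (x, y - 1) = northShape n k i j (x', y - 1))
    (hW : eastShape n k j (x - 1, y) = eastShape n k j (x' - 1, y)) (d : Dir) :
    label n k i j (x, y) d = label n k i j (x', y) d := by
  have e : ∀ x, n - (x - 1) - 1 = n - x := fun x => by ring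
  have hW' := eastShape_eq_digit.1 (hW.trans (eastShape_eq_digit.2
    ⟨hyk, show 0 ≤ x' - 1 by omega, show ¬ LowZero y (n - (x' - 1) - 1) by rwa [e], rfl⟩))
  simp only [e] at hW'
  obtain ⟨-, -, hz₁, hbit⟩ := hW'
  have hS' := northShape_eq_agree.1 (hS.trans (northShape_eq_agree.2
    ⟨show 0 ≤ y - 1 by omega, show y - 1 < k - 1 by omega, show x' ≠ 0 by omega,
      show ¬ LowZero (y - 1 + 1) (n - x') by rwa [sub_add_cancel], rfl, rfl, rfl, rfl⟩))
  simp only [sub_add_cancel, decide_eq_decide] at hS'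
  obtain ⟨-, -, -, -, h0, h1, h2, h3⟩ := hS'
  have hb : bit y (n - x - 1) = bit y (n - x' - 1) := by
    rw [bit_sub_one hz₁, bit_sub_one hz, hbit]
  have step : ∀ c, (LowZero y (n - x - 1 - c) ↔ LowZero y (n - x' - 1 - c)) →
      (LowZero (y + 1) (n - x - 1 - c) ↔ LowZero (y + 1) (n - x' - 1 - c)) := fun c hc => by
    rw [lowZero_succ_sub hy.le, lowZero_succ_sub hy.le, hc, hb]
  refine label_ext (p := (x, y)) (q := (x', y)) (Or.inl rfl) ?_ ?_ hS hW d
  · by_cases hk : y < k - 1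
    · have hd : ¬ LowZero (y + 1) (n - x) := fun hh => hz₁ hh.pred
      have hd' : ¬ LowZero (y + 1) (n - x') := fun hh => hz hh.pred
      simp only [northShape, not_lt.2 hy.le, hk, if_false, if_true, hd, hd',
        show x ≠ 0 by omega, show x' ≠ 0 by omega, step _ h0, step _ h1, step _ h2, step _ h3]
    · have hyk' : y + 1 = k := by omega
      have hin : ∀ c, 0 ≤ c ∧ c < n →
          (LowZero y (n - x - 1 - (n - 1 - c)) ↔ LowZero y (n - x' - 1 - (n - 1 - c))) →
          (x = c ↔ x' = c) := fun c hc hh => by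
        rw [← h.lowZero_iff ⟨by omega, by omega⟩ hc, ← h.lowZero_iff ⟨by omega, by omega⟩ hc,
          ← hyk', step _ hh]
      have hk1 := h.one_le
      simp only [northShape, not_lt.2 hy.le, hk, if_false, hyk',
        hin k ⟨by omega, h.lt⟩ h1, hin i ⟨h.i_nonneg, h.i_lt⟩ h2, hin j ⟨h.j_nonneg, h.j_lt⟩ h3]
  · have s0 := step _ h0
    rw [sub_zero, sub_zero] at s0 h0
    simp only [eastShape, hyk, if_true, show ¬ x < 0 by omega, show ¬ x' < 0 by omega, if_false,
      s0, h0, hb]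

/-- In the counter, the row number fixes y, and the inputs fix all that matters of n - x; above it,
the marks suffice. No boundary tiles are needed: a cooperating cell has one input neighbour bounding
its column and one bounding its row, and the diagonal ends with the columns. -/
theorem Fits.determined (h : Fits n k i j)
    (hq : (0 ≤ q.1 ∧ q.1 < n) ∧ (0 ≤ q.2 ∧ q.2 < n)) (hq0 : q ≠ (0, 0))
    (hin : ∀ d, 0 < inputStrength n k i j q d →
      ((0 ≤ (p + d.vec).1 ∧ (p + d.vec).1 < n) ∧ (0 ≤ (p + d.vec).2 ∧ (p + d.vec).2 < n)) ∧
        label n k i j p d = label n k i j q d) :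
    ((0 ≤ p.1 ∧ p.1 < n) ∧ (0 ≤ p.2 ∧ p.2 < n)) ∧
      ∀ d, label n k i j p d = label n k i j q d := by
  obtain ⟨x, y⟩ := p
  obtain ⟨x', y'⟩ := q
  have hk := h.one_le
  have hkn := h.lt
  have e : ∀ x, n - (x - 1) - 1 = n - x := fun x => by ring
  have inN := hin .north
  have inE := hin .east
  have inS := hin .south
  have inW := hin .west
  simp only [label, sideLabel, Prod.mk.injEq, Dir.vec, Prod.mk_add_mk, add_zero,
    ← sub_eq_add_neg] at inN inE inS inW
  simp only at hq
  rcases h.kind (p := (x', y')) hq with ⟨h1, hN, hE, hS, hW⟩ | ⟨h1, hN, hE, hS, hW⟩ |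
    ⟨h1, hz, hN, hE, hS, hW⟩ | ⟨h1, hz, hz', hN, hE, hS, hW⟩ | ⟨h1, hz, hN, hE, hS, hW⟩ |
    ⟨h1, hN, hE, hS, hW⟩ | ⟨h1, hN, hE, hS, hW⟩ | ⟨h1, hN, hE, hS, hW⟩ <;> simp only at h1
  · exact absurd (Prod.ext h1.1 h1.2) hq0
  · obtain ⟨hb, hs, hi⟩ := inS (by omega)
    have := northShape_eq_start.1 (hs.trans (northShape_eq_start.2
      ⟨show 0 ≤ y' - 1 by omega, show y' - 1 < k - 1 by omega, h1.1⟩))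
    simp only at this
    obtain rfl : x = x' := by omega
    obtain rfl : y = y' := by omega
    exact ⟨hq, fun _ => rfl⟩
  · obtain ⟨hb, hs, hi⟩ := inN (by omega)
    simp only at hz
    have := northShape_eq_down.1 (hs.trans (northShape_eq_down.2
      ⟨hq.2.1, h1.2, show x' ≠ 0 by omega, hz⟩))
    simp only at this
    obtain rfl : y = y' := by omega
    exact ⟨⟨hb.1, hq.2⟩, h.label_congr (by omega) (by omega) hq.2.1 (by omega)
      (dvd_sub this.2.2.2 hz)⟩
  · obtain ⟨hb, hs, hi⟩ := inW (by omega)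
    simp only at hz hz'
    have := eastShape_eq_strong.1 (hs.trans (eastShape_eq_strong.2
      ⟨h1.2, show 0 ≤ x' - 1 by omega, by simpa only [e] using hz', by simpa only [e] using hz⟩))
    simp only [e] at this
    obtain rfl : y = y' := by omega
    -- A column beyond the last would receive 0, which has no set bit and so no strong glue.
    have hxn : x ≠ n := by
      rintro rfl
      exact this.2.2.1 (by rw [sub_self]; exact dvd_zero _)
    exact ⟨⟨by omega, hq.2⟩, h.label_congr (by omega) (by omega) hq.2.1 (by omega)
      (lowZero_sub_of_not hq.2.1 this.2.2.2 this.2.2.1 hz hz')⟩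
  · obtain ⟨hb, hs, hi⟩ := inW (by omega)
    obtain ⟨hb', hs', hi'⟩ := inS (by omega)
    obtain rfl : y = y' := by omega
    exact ⟨by omega, h.determined_digit (by omega) (by omega) h1.2.1 h1.2.2 hz hs' hs⟩
  · obtain ⟨hb, hs, hi⟩ := inS (by omega)
    have := (northShape_eq_up hk).1 (hs.trans ((northShape_eq_up hk).2
      ⟨show k - 1 ≤ y' - 1 by omega, rfl, rfl, rfl⟩))
    simp only [sub_add_cancel, decide_eq_decide] at this
    obtain ⟨t0, t1, t2, t3⟩ := this
    -- The southern mark puts p on the diagonal as well, so y = x < n.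
    have hxy : x = y := t1.2 h1.2
    have hxy' : x' = y' := h1.2
    subst hxy hxy'
    refine ⟨by omega, label_ext (Or.inr (by simp only; omega)) ?_ ?_ hs ?_⟩
    · rw [(northShape_eq_up hk).2 ⟨show k - 1 ≤ x by omega, rfl, rfl, rfl⟩,
        (northShape_eq_up hk).2 ⟨show k - 1 ≤ x' by omega, rfl, rfl, rfl⟩]
      simp [t2, t3]
    -- On the diagonal the mark of column j turns into the mark of row j.
    · rw [eastShape_eq_east.2 ⟨show k ≤ x by omega, show x ≤ x by omega, rfl, rfl⟩,
        eastShape_eq_east.2 ⟨show k ≤ x' by omega, show x' ≤ x' by omega, rfl, rfl⟩]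
      simp [t3]
    · rw [eastShape_eq_west.2 ⟨show k ≤ x by omega, show x - 1 < x by omega, rfl⟩,
        eastShape_eq_west.2 ⟨show k ≤ x' by omega, show x' - 1 < x' by omega, rfl⟩]
      simp [t3]
  · obtain ⟨hb, hs, hi⟩ := inS (by omega)
    obtain ⟨hb', hs', hi'⟩ := inW (by omega)
    have ht := (northShape_eq_up hk).1 (hs.trans ((northShape_eq_up hk).2
      ⟨show k - 1 ≤ y' - 1 by omega, rfl, rfl, rfl⟩))
    simp only [decide_eq_decide] at ht
    obtain ⟨t0, t1, t2, t3⟩ := ht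
    have hu := eastShape_eq_east.1 (hs'.trans (eastShape_eq_east.2
      ⟨h1.1, show y' ≤ x' - 1 by omega, rfl, rfl⟩))
    simp only [decide_eq_decide] at hu
    obtain ⟨u0, u1, u2, u3⟩ := hu
    refine ⟨by omega, label_ext (Or.inr (by simp only; omega)) ?_ ?_ hs hs'⟩
    · rw [(northShape_eq_up hk).2 ⟨show k - 1 ≤ y by omega, rfl, rfl, rfl⟩,
        (northShape_eq_up hk).2 ⟨show k - 1 ≤ y' by omega, rfl, rfl, rfl⟩]
      simp only [t2, t3, show x = y + 1 ↔ x' = y' + 1 by omega]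
    · rw [eastShape_eq_east.2 ⟨u0, show y ≤ x by omega, rfl, rfl⟩,
        eastShape_eq_east.2 ⟨h1.1, show y' ≤ x' by omega, rfl, rfl⟩]
      simp only [u3, show x = y ↔ x' = y' by omega]
  · obtain ⟨hb, hs, hi⟩ := inS (by omega)
    obtain ⟨hb', hs', hi'⟩ := inE (by omega)
    have ht := (northShape_eq_up hk).1 (hs.trans ((northShape_eq_up hk).2
      ⟨show k - 1 ≤ y' - 1 by omega, rfl, rfl, rfl⟩))
    simp only [decide_eq_decide] at ht
    obtain ⟨t0, t1, t2, t3⟩ := ht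
    have hu := eastShape_eq_west.1 (hs'.trans (eastShape_eq_west.2 ⟨h1.1, h1.2, rfl⟩))
    simp only [decide_eq_decide] at hu
    obtain ⟨u0, u1, u2⟩ := hu
    refine ⟨by omega, label_ext (Or.inr (by simp only; omega)) ?_ hs' hs ?_⟩
    · rw [(northShape_eq_up hk).2 ⟨show k - 1 ≤ y by omega, rfl, rfl, rfl⟩,
        (northShape_eq_up hk).2 ⟨show k - 1 ≤ y' by omega, rfl, rfl, rfl⟩]
      simp only [t2, t3, show x = y + 1 ↔ x' = y' + 1 by omega]
    · rw [eastShape_eq_west.2 ⟨u0, show x - 1 < y by omega, rfl⟩,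
        eastShape_eq_west.2 ⟨h1.1, show x' - 1 < y' by omega, rfl⟩]
      simp only [u2]

/-- A plan for the square that has `O(k)` tile types. -/
noncomputable def blueprint {m : ℕ} (h : Fits m k i j) : Blueprint (Shape × ℤ) where
  cells := square m
  seed := (0, 0)
  label := label m k i j
  strength l := l.1.strength
  flow l := l.1.flow
  rank p := (rank m k p).toNat
  seed_mem := by
    have := h.one_le
    have := h.lt
    rw [mem_square]
    simp only
    omega
  label_opp := sideLabel_opp _ _
  flow_axis _ _ d hd := flow_axis d hd
  seed_input d h0 h1 := by
    have hd := inputStrength_pos h0 h1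
    have h1 := h.one_le
    have h2 := h.lt
    rcases h.kind (p := (0, 0)) (by simp only; omega) with ⟨h1, hN, hE, hS, hW⟩ |
      ⟨h1, -⟩ | ⟨h1, -⟩ | ⟨h1, -⟩ | ⟨h1, -⟩ | ⟨h1, -⟩ | ⟨h1, -⟩ | ⟨h1, -⟩
    · cases d <;> omega
    all_goals simp only at h1; omega
  sum_input p hp hps := by
    rw [mem_square] at hp
    change ∑ d, inputStrength m k i j p d = 2
    rw [Dir.sum_univ]
    rcases h.kind hp with ⟨h1, hN, hE, hS, hW⟩ | ⟨h1, hN, hE, hS, hW⟩ |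
      ⟨h1, hz, hN, hE, hS, hW⟩ | ⟨h1, hz, hz', hN, hE, hS, hW⟩ | ⟨h1, hz, hN, hE, hS, hW⟩ |
      ⟨h1, hN, hE, hS, hW⟩ | ⟨h1, hN, hE, hS, hW⟩ | ⟨h1, hN, hE, hS, hW⟩
    · exact absurd (Prod.ext h1.1 h1.2) hps
    all_goals omega
  input_mem p hp d h0 h1 := by
    rw [mem_square] at hp ⊢
    have := h.input_mem hp d (inputStrength_pos h0 h1)
    exact ⟨this.1, by omega⟩
  determined q hq hqs p hin := by
    simp only [mem_square] at hq hin ⊢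
    refine h.determined hq hqs fun d hd => ?_
    exact hin d (input_of_inputStrength_pos hd).1 (input_of_inputStrength_pos hd).2

/-- The southern input carries the mark of column i and the horizontal one the mark of row j. On the
diagonal, where no horizontal input exists, the column determines the row. -/
theorem blueprint_unique {m : ℕ} (h : Fits m k i j) (hj : k ≤ j) {p : Pos}
    (hl : ∀ d, 0 < (label m k i j (i, j) d).1.strength →
      label m k i j p d = label m k i j (i, j) d) : p = (i, j) := by
  have hk := h.one_le
  have hi := h.i_nonneg
  have hpos : ∀ d, 0 < inputStrength m k i j (i, j) d →
      label m k i j p d = label m k i j (i, j) d := fun d hd =>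
    hl d (input_of_inputStrength_pos hd).1
  have inE := hpos .east
  have inS := hpos .south
  have inW := hpos .west
  simp only [label, sideLabel, Prod.mk.injEq] at inE inS inW
  have hS0 : 0 < inputStrength m k i j (i, j) .south := by
    rw [inputStrength_south_of_up hk hj]
    split_ifs <;> norm_num
  have ht := (northShape_eq_up hk).1 ((inS hS0).1.trans ((northShape_eq_up hk).2
      ⟨show k - 1 ≤ j - 1 by omega, rfl, rfl, rfl⟩))
  simp only [decide_eq_decide, sub_add_cancel, iff_true] at ht
  refine Prod.ext ht.2.2.1 ?_
  simp only
  rcases lt_trichotomy i j with hlt | heq | hgt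
  · have hE0 : 0 < inputStrength m k i j (i, j) .east := by
      rw [inputStrength_east, if_pos ⟨hj, hlt⟩]
      norm_num
    have hu := eastShape_eq_west.1 ((inE hE0).1.trans (eastShape_eq_west.2 ⟨hj, hlt, rfl⟩))
    simp only [decide_eq_decide, iff_true] at hu
    exact hu.2.2
  · omega
  · have hW0 : 0 < inputStrength m k i j (i, j) .west := by
      rw [inputStrength_west_of_le hj, if_pos hgt]
      norm_num
    have hu := eastShape_eq_east.1 ((inW hW0).1.trans (eastShape_eq_east.2
      ⟨hj, show j ≤ i - 1 by omega, rfl, rfl⟩))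
    simp only [decide_eq_decide, iff_true] at hu
    exact hu.2.2.2

end Counter

end ATAM

/-! ### Counting tile types, and the choice of parameters. -/

namespace ATAM

open Classical in
theorem Blueprint.card_tiles_le {L : Type} [Countable L] {A : Type*} (B : Blueprint L) (a : A)
    {ι : Type*} (F : ι → Dir → L) (s : Finset ι) (h : ∀ p ∈ B.cells, ∃ c ∈ s, B.label p = F c) :
    (B.cells.image (B.tile a)).card ≤ s.card := by
  refine (Finset.card_le_card fun t ht => ?_).trans
    (Finset.card_image_le (s := s) (f := fun c d => B.glue a (F c d)))
  obtain ⟨p, hp, rfl⟩ := Finset.mem_image.1 ht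
  obtain ⟨c, hc, e⟩ := h p hp
  refine Finset.mem_image.2 ⟨c, hc, ?_⟩
  funext d
  rw [Blueprint.tile, e]

namespace Counter

/-- The labels of a tile, given by its row and their kinds. -/
def rowLabel (k : ℤ) (c : ℤ × (Dir → Shape)) : Dir → Shape × ℤ
  | .north => (c.2 .north, min c.1 (k - 1))
  | .east => (c.2 .east, c.1)
  | .south => (c.2 .south, c.1 - 1)
  | .west => (c.2 .west, c.1)

/-- All rows from k on share the number k, so k + 1 row numbers and boundedly many shapes describe
every tile. -/
theorem exists_label_eq_rowLabel {n k i j : ℤ} (hk : 1 ≤ k) {p : Pos} (hp : 0 ≤ p.2) :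
    ∃ c ∈ Finset.Icc 0 k ×ˢ (Finset.univ : Finset (Dir → Shape)),
      label n k i j p = rowLabel k c := by
  refine ⟨(min p.2 k, fun d => (label n k i j p d).1), ?_, ?_⟩
  · simp only [Finset.mem_product, Finset.mem_Icc, Finset.mem_univ, and_true]
    omega
  · funext d
    cases d <;> simp only [label, Blueprint.sideLabel, rowLabel, Prod.mk.injEq, true_and]
    · omega
    · omega

theorem card_rows (k : ℕ) :
    (Finset.Icc 0 (k : ℤ) ×ˢ (Finset.univ : Finset (Dir → Shape))).card =
      (k + 1) * Fintype.card (Dir → Shape) := by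
  rw [Finset.card_product, Int.card_Icc, Finset.card_univ]
  congr 1

end Counter

theorem exists_singlePixel_of_small {A : Type*} (a : A) {n i j : ℕ} (hi : i < n) (hj : j < n) :
    ∃ (𝒯 : TAS A) (color : TileType A → Color),
      𝒯.temp = 2 ∧ 𝒯.seed.dom.ncard = 1 ∧ 𝒯.tiles.card ≤ n * n ∧
      𝒯.WeaklySelfAssembles color Set.univ (singlePixel n i j) := by
  classical
  have hn : 0 < n := by omega
  obtain ⟨𝒯, color, h1, h2, h3, h4⟩ :=
    (Blueprint.comb n hn).exists_weaklySelfAssembles_singlePixel a (i := i) (j := j) rfl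
      fun p hp h => Blueprint.comb_unique hn hp (Blueprint.mem_square.2 (by simp only; omega)) h
  refine ⟨𝒯, color, h1, h2, ?_, h4⟩
  rw [h3]
  refine Finset.card_image_le.trans (le_of_eq ?_)
  change (Blueprint.square n).card = _
  simp [Blueprint.square]

theorem exists_singlePixel_of_fits {A : Type*} (a : A) {n k i j : ℕ} (hk : 1 ≤ k)
    (hkn : 2 * k < n) (hn : n ≤ 2 ^ k) (hi : i < n) (hj : j < n) :
    ∃ (𝒯 : TAS A) (color : TileType A → Color),
      𝒯.temp = 2 ∧ 𝒯.seed.dom.ncard = 1 ∧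
      𝒯.tiles.card ≤ (k + 1) * Fintype.card (Dir → Counter.Shape) ∧
      𝒯.WeaklySelfAssembles color Set.univ (singlePixel n i j) := by
  classical
  have hfits : ∀ j' : ℤ, 0 ≤ j' → j' < n → Counter.Fits n k i j' := fun j' h0 h1 =>
    ⟨by omega, by omega, by rw [Int.toNat_natCast]; exact_mod_cast hn, by omega, by omega, h0, h1⟩
  by_cases hjk : k ≤ j
  · have h := hfits j (by omega) (by omega)
    obtain ⟨𝒯, color, h1, h2, h3, h4⟩ :=
      (Counter.blueprint h).exists_weaklySelfAssembles_singlePixel a (i := i) (j := j) rfl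
        fun p _ hl => Counter.blueprint_unique h (by omega) hl
    refine ⟨𝒯, color, h1, h2, ?_, h4⟩
    rw [h3, ← Counter.card_rows]
    refine Blueprint.card_tiles_le _ a (Counter.rowLabel k) _ fun p hp => ?_
    exact Counter.exists_label_eq_rowLabel h.one_le (Blueprint.mem_square.1 hp).2.1
  -- Row j lies inside the counter; its mirror image n - 1 - j is at least k because 2k < n.
  · have h := hfits (n - 1 - j) (by omega) (by omega)
    obtain ⟨𝒯, color, h1, h2, h3, h4⟩ :=
      ((Counter.blueprint h).flip n rfl).exists_weaklySelfAssembles_singlePixel a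
        (i := i) (j := j) rfl fun p _ hl => by
          rw [← flipPos_flipPos n p,
            Counter.blueprint_unique h (p := flipPos n p) (by omega) fun d hd => ?_]
          · simp [flipPos]
          · have := hl d.flip
            simp only [Blueprint.flip, Dir.flip_flip] at this
            exact this hd
    refine ⟨𝒯, color, h1, h2, ?_, h4⟩
    rw [h3, ← Counter.card_rows]
    refine Blueprint.card_tiles_le _ a (fun c d => Counter.rowLabel k c d.flip) _ fun p hp => ?_
    have hp' : flipPos n p ∈ Blueprint.square n := Blueprint.flipPos_mem_square.2 hp
    obtain ⟨c, hc, e⟩ := Counter.exists_label_eq_rowLabel (n := n) (i := i) (j := n - 1 - j)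
      h.one_le (Blueprint.mem_square.1 hp').2.1
    refine ⟨c, hc, ?_⟩
    funext d
    exact congrFun e d.flip

/-- The threshold is sharp: for n = 6 both sides are 6. -/
theorem two_mul_clog_lt {n : ℕ} (hn : 7 ≤ n) : 2 * Nat.clog 2 n < n := by
  have h : ∀ m, 3 ≤ m → 2 * m + 2 ≤ 2 ^ m := fun m hm => by
    induction m, hm using Nat.le_induction with
    | base => norm_num
    | succ m hm ih =>
      rw [pow_succ]
      omega
  have h1 := h ((n - 1) / 2) (by omega)
  have h2 : Nat.clog 2 n ≤ (n - 1) / 2 := Nat.clog_le_of_le_pow (by omega)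
  omega

theorem clog_le_log (n : ℕ) : (Nat.clog 2 n : ℝ) ≤ Real.log n / Real.log 2 + 1 := by
  have h := Real.natCeil_logb_natCast 2 n
  rw [← h]
  rcases Nat.eq_zero_or_pos n with rfl | hn
  · simp
  · have h0 : 0 ≤ Real.logb (2 : ℕ) n :=
      Real.logb_nonneg (by norm_num) (by exact_mod_cast hn)
    exact (Nat.ceil_lt_add_one h0).le

end ATAM

theorem theorem1 (A : Type*) [Nonempty A] :
    ∃ f : ℕ → ℝ, Asymptotics.IsBigO Filter.atTop f (fun n : ℕ => Real.log n) ∧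
      ∀ n i j : ℕ, i < n → j < n →
        ∃ (𝒯 : ATAM.TAS A) (color : ATAM.TileType A → ATAM.Color),
          𝒯.temp = 2 ∧ 𝒯.seed.dom.ncard = 1 ∧ (𝒯.tiles.card : ℝ) ≤ f n ∧
          𝒯.WeaklySelfAssembles color Set.univ (ATAM.singlePixel n i j) := by
  obtain ⟨a⟩ := ‹Nonempty A›
  obtain ⟨C, hC⟩ : ∃ C : ℕ, C = Fintype.card (ATAM.Dir → ATAM.Counter.Shape) := ⟨_, rfl⟩
  -- There are at most `C` types for each of k + 1 ≤ log n / log 2 + 2 row numbers; 36 = 6 · 6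
  -- covers the combs.
  refine ⟨fun n => C / Real.log 2 * Real.log n + (2 * C + 36), ?_, fun n i j hi hj => ?_⟩
  · refine ((Asymptotics.isBigO_refl _ _).const_mul_left _).add ?_
    exact (Asymptotics.isLittleO_const_left.2 (Or.inr (tendsto_norm_atTop_atTop.comp
      (Real.tendsto_log_atTop.comp tendsto_natCast_atTop_atTop)))).isBigO
  · have hlog : 0 ≤ (C : ℝ) / Real.log 2 * Real.log n :=
      mul_nonneg (div_nonneg (Nat.cast_nonneg _) (Real.log_nonneg (by norm_num)))
        (Real.log_natCast_nonneg n)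
    by_cases hn : 7 ≤ n
    · obtain ⟨𝒯, color, h1, h2, h3, h4⟩ := ATAM.exists_singlePixel_of_fits a (k := Nat.clog 2 n)
        (Nat.clog_pos (by norm_num) (by omega)) (ATAM.two_mul_clog_lt hn)
        (Nat.le_pow_clog (by norm_num) n) hi hj
      refine ⟨𝒯, color, h1, h2, ?_, h4⟩
      rw [← hC] at h3
      have h5 : (𝒯.tiles.card : ℝ) ≤ (Nat.clog 2 n + 1) * C := by exact_mod_cast h3
      have h6 := mul_le_mul_of_nonneg_right (ATAM.clog_le_log n) (Nat.cast_nonneg (α := ℝ) C)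
      have h7 : Real.log n / Real.log 2 * C = C / Real.log 2 * Real.log n := by ring
      linarith
    · obtain ⟨𝒯, color, h1, h2, h3, h4⟩ := ATAM.exists_singlePixel_of_small a hi hj
      refine ⟨𝒯, color, h1, h2, ?_, h4⟩
      have h5 : 𝒯.tiles.card ≤ 36 := h3.trans (Nat.mul_le_mul (by omega) (by omega) : n * n ≤ 6 * 6)
      have h6 : (𝒯.tiles.card : ℝ) ≤ 36 := by exact_mod_cast h5
      have h7 : (0 : ℝ) ≤ C := Nat.cast_nonneg C
      linarith
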